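/- Let $d_x,d_y\ge 0$ be integers, $d=d_x+d_y\ge 1$, and write $z=(x,y)\in\mathbb R^{d}$ for $x\in\mathbb R^{d_x}$, $y\in\mathbb R^{d_y}$, with the Euclidean norm. Let $\mathcal X\subseteq\mathbb R^{d_x}$ and $\mathcal Y\subseteq\mathbb R^{d_y}$ be such that $\mathcal Z=\mathcal X\times\mathcal Y$ is nonempty, compact and convex, and put $\tilde D=\max_{z,z'\in\mathcal Z}\|z-z'\|$. Let $r_k>0$ $(k\ge 0)$ be smoothing radii with $$\sum_{k=1}^\infty r_k=M_1<\infty,\qquad \sum_{k=1}^\infty r_k^2=M_2<\infty ,$$ and let $\mathcal S=\{p\in\mathbb R^d:\ \|p-z\|\le r_k\text{ for some }z\in\mathcal Z,\ k\ge 0\}$ be the region in which the algorithm below may evaluate $f$. Let $f:\mathbb R^{d}\to\mathbb R$ satisfy: 1. $f$ is continuously differentiable on $\mathcal S$ (differentiable at each point of $\mathcal S$, with $\nabla f$ continuous on $\mathcal S$); $f(\cdot,y)$ is convex on $\mathcal X$ for every $y\in\mathcal Y$, and $f(x,\cdot)$ is concave on $\mathcal Y$ for every $x\in\mathcal X$;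 2. for all $z_1,z_2\in\mathcal S$, $\|\nabla f(z_1)-\nabla f(z_2)\|\le L\|z_1-z_2\|$ and $|f(z_1)-f(z_2)|\le G\|z_1-z_2\|$. Let $z^*=(x^*,y^*)\in\mathcal Z$ be a saddle point of $f$ on $\mathcal X\times\mathcal Y$, i.e. $f(x^*,y)\le f(x^*,y^*)\le f(x,y^*)$ for all $x\in\mathcal X$, $y\in\mathcal Y$, and let $\Delta(z)=f(x,y^*)-f(x^*,y)$ for $z=(x,y)\in\mathcal Z$. Fix a step size $\eta>0$ and an initial point $z_0\in\mathcal Z$. Let $v_0,w_0,v_1,w_1,\dots$ be mutually independent random vectors, each uniformly distributed on the unit sphere of $\mathbb R^d$. For a vector $v=(v_x,v_y)$ let $\tilde v=(v_x,-v_y)$, let $\mathcal P_{\mathcal Z}$ be the Euclidean projection onto $\mathcal Z$, and define for $k\ge 0$ (zeroth-order extra-gradient method) $$g_k=\frac{f(z_k+r_kv_k)-f(z_k)}{r_k/d}\,\tilde v_k,\qquad z_k^+=\mathcal P_{\mathcal Z}[z_k-\eta g_k],$$ $$g_k^+=\frac{f(z_k^++r_kw_k)-f(z_k^+)}{r_k/d}\,\tilde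 w_k,\qquad z_{k+1}=\mathcal P_{\mathcal Z}[z_k-\eta g_k^+].$$ Then for every integer $K>1$ the averaged iterate $\hat z_K=\frac1K\sum_{k=0}^{K-1}z_k^+$ has an integrable duality gap $\Delta(\hat z_K)$, and $$\mathbb E[\Delta(\hat z_K)]\le\frac{\tilde D^2}{2\eta K}+\frac{C_1\eta+C_2}{K}+108\,\eta\,d\,G^2,\qquad C_1=(9L^2+12)d^2M_2,\quad C_2=L\tilde DM_1 .$$ -/

import Mathlib

open MeasureTheory ProbabilityTheory

/-- The space `ℝ^{d_x + d_y}` of concatenated vectors `z = (x, y)`, with the Euclidean norm. -/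
abbrev PrimalDual (dx dy : ℕ) : Type := EuclideanSpace ℝ (Fin dx ⊕ Fin dy)

/-- The concatenation `z = (x, y)`. -/
def concat {dx dy : ℕ} (x : EuclideanSpace ℝ (Fin dx)) (y : EuclideanSpace ℝ (Fin dy)) :
    PrimalDual dx dy :=
  WithLp.toLp 2 (Sum.elim x y)

/-- The `x`-block of `z`. -/
def xPart {dx dy : ℕ} (z : PrimalDual dx dy) : EuclideanSpace ℝ (Fin dx) :=
  WithLp.toLp 2 (fun i => z (Sum.inl i))

/-- The `y`-block of `z`. -/
def yPart {dx dy : ℕ} (z : PrimalDual dx dy) : EuclideanSpace ℝ (Fin dy) :=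
  WithLp.toLp 2 (fun j => z (Sum.inr j))

/-- The product `𝒵 = 𝒳 × 𝒴` as a set of concatenated vectors. -/
def feasibleSet {dx dy : ℕ} (X : Set (EuclideanSpace ℝ (Fin dx)))
    (Y : Set (EuclideanSpace ℝ (Fin dy))) : Set (PrimalDual dx dy) :=
  {z | xPart z ∈ X ∧ yPart z ∈ Y}

/-- `[v_x; v_y] ↦ [v_x; -v_y]`. -/
def flipDual {dx dy : ℕ} (v : PrimalDual dx dy) : PrimalDual dx dy :=
  concat (xPart v) (-yPart v)

/-- All points at distance at most `r k`, for some `k`, from a point of `Z`: the region in which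
the algorithm with smoothing radii `r` may evaluate the objective. -/
def queryRegion {dx dy : ℕ} (Z : Set (PrimalDual dx dy)) (r : ℕ → ℝ) :
    Set (PrimalDual dx dy) :=
  {p | ∃ k : ℕ, ∃ z ∈ Z, ‖p - z‖ ≤ r k}

/-- The Euclidean projection `𝒫_Z`: a point of `Z` nearest to `p` (unique if `Z` is nonempty,
closed and convex). -/
noncomputable def proj {dx dy : ℕ} (Z : Set (PrimalDual dx dy)) (p : PrimalDual dx dy) :
    PrimalDual dx dy :=
  Classical.epsilon (fun q => q ∈ Z ∧ ∀ z ∈ Z, ‖p - q‖ ≤ ‖p - z‖)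

theorem proj_spec {dx dy : ℕ} {Z : Set (PrimalDual dx dy)} (hZ : IsCompact Z)
    (hne : Z.Nonempty) (p : PrimalDual dx dy) :
    proj Z p ∈ Z ∧ ∀ z ∈ Z, ‖p - proj Z p‖ ≤ ‖p - z‖ := by
  have h : ∃ q, q ∈ Z ∧ ∀ z ∈ Z, ‖p - q‖ ≤ ‖p - z‖ := by
    obtain ⟨q, hq, hmin⟩ := hZ.exists_isMinOn hne
      (f := fun z => ‖p - z‖) (by fun_prop)
    exact ⟨q, hq, fun z hz => hmin hz⟩
  exact Classical.epsilon_spec h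

/-- The uniform distribution `𝒰(𝕊_{d-1})`: the normalized surface measure of the unit sphere. -/
noncomputable def uniformSphere (dx dy : ℕ) :
    Measure (Metric.sphere (0 : PrimalDual dx dy) 1) :=
  ((volume : Measure (PrimalDual dx dy)).toSphere Set.univ)⁻¹ •
    (volume : Measure (PrimalDual dx dy)).toSphere

/-- The two-point estimator `(f(z + r v) - f(z)) / (r / d) · ṽ` of
`F(z) = [∇ₓ f(z); -∇_y f(z)]`, where `d = d_x + d_y` and `ṽ = [v_x; -v_y]`. -/
noncomputable def gradEst {dx dy : ℕ} (f : PrimalDual dx dy → ℝ) (r : ℝ)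
    (z v : PrimalDual dx dy) : PrimalDual dx dy :=
  ((f (z + r • v) - f z) / (r / ((dx + dy : ℕ) : ℝ))) • flipDual v

/-- The mid-point `z⁺ = 𝒫_Z[z - η g]`, where `g` is the estimate at `z` in direction `v`. -/
noncomputable def midPoint {dx dy : ℕ} (f : PrimalDual dx dy → ℝ) (Z : Set (PrimalDual dx dy))
    (η r : ℝ) (z v : PrimalDual dx dy) : PrimalDual dx dy :=
  proj Z (z - η • gradEst f r z v)

/-- The iterates `z_k` of the zeroth-order extra-gradient method along a realization
`v_0, w_0, v_1, w_1, …` of the sampled directions: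
`z_{k+1} = 𝒫_Z[z_k - η g_k⁺]`, where `g_k⁺` is the estimate at `z_k⁺` in direction `w_k`. -/
noncomputable def zoegIter {dx dy : ℕ} (f : PrimalDual dx dy → ℝ) (Z : Set (PrimalDual dx dy))
    (η : ℝ) (r : ℕ → ℝ) (z₀ : PrimalDual dx dy) (v w : ℕ → PrimalDual dx dy) :
    ℕ → PrimalDual dx dy
  | 0 => z₀
  | k + 1 =>
      proj Z (zoegIter f Z η r z₀ v w k -
        η • gradEst f (r k) (midPoint f Z η (r k) (zoegIter f Z η r z₀ v w k) (v k)) (w k))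

/-- The mid-points `z_k⁺ = 𝒫_Z[z_k - η g_k]`. -/
noncomputable def zoegMid {dx dy : ℕ} (f : PrimalDual dx dy → ℝ) (Z : Set (PrimalDual dx dy))
    (η : ℝ) (r : ℕ → ℝ) (z₀ : PrimalDual dx dy) (v w : ℕ → PrimalDual dx dy) (k : ℕ) :
    PrimalDual dx dy :=
  midPoint f Z η (r k) (zoegIter f Z η r z₀ v w k) (v k)

/-- The output `ẑ_K = (1/K) ∑_{k<K} z_k⁺` after `K` iterations. -/
noncomputable def zoegOutput {dx dy : ℕ} (f : PrimalDual dx dy → ℝ) (Z : Set (PrimalDual dx dy))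
    (η : ℝ) (r : ℕ → ℝ) (z₀ : PrimalDual dx dy) (v w : ℕ → PrimalDual dx dy) (K : ℕ) :
    PrimalDual dx dy :=
  (1 / (K : ℝ)) • ∑ k ∈ Finset.range K, zoegMid f Z η r z₀ v w k

/-- The duality gap `Δ(z) = f(x, y*) - f(x*, y)` with respect to the saddle point `(x*, y*)`. -/
def dualityGap {dx dy : ℕ} (f : PrimalDual dx dy → ℝ) (xs : EuclideanSpace ℝ (Fin dx))
    (ys : EuclideanSpace ℝ (Fin dy)) (z : PrimalDual dx dy) : ℝ :=
  f (concat (xPart z) ys) - f (concat xs (yPart z))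

/-! ### Rotation invariance, integration by parts and moments on the unit sphere -/

section Sphere

open Metric Set Topology

/-! Write F(z) for the flipped gradient of f, d for the dimension and D for the diameter of the
feasible set. Three estimates combine.

(1) Deterministic step (`extragradient_step_le`). Nonexpansiveness of the projection bounds 2η⟨g⁺,
z⁺ - z*⟩ by the decrease of the squared distance to z* plus η²(2‖g⁺‖² + ‖g‖²). No relation between g
and g⁺ is needed, so no smoothness enters here.

(2) Moments of the estimator. Its second moment is at most 2dG² + 2d²L²r²
(`integral_norm_gradEst_sq_le`): the mean of ⟨∇f, w⟩² over the sphere is ‖∇f‖²/d, which cancels one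
factor of d² in the leading term. Its mean, paired with z - z*, falls below ⟨F(z), z - z*⟩ by at
most L r D (`inner_gradient_le_integral`). Convexity-concavity gives Δ(z) ≤ ⟨F(z), z - z*⟩
(`dualityGap_le_inner`).

(3) Independence. The point z_k is a function of the directions drawn before v_k, and z_k⁺ of those
drawn before w_k, so the estimates of (2), uniform in z, may be averaged along the trajectory
(`ProbabilityTheory.IndepFun.integral_le`).

Summing over k telescopes, and Jensen's inequality passes to the averaged iterate. The sums M₁ and
M₂ do not control r_0, so the sum starts at k = 1; iteration 0 costs at most G D by the Lipschitz
bound. This extra term is absorbed by the generous constants (`average_gap_le`).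

The usual divergence theorem behind the bias estimate in (2) is replaced by rotation invariance.
Differentiating an integral along a one-parameter group of plane rotations gives tangential
integration by parts on the sphere (`IsometryInvariant.integral_mul_coord`); integrating the result
over radii gives the ball version (`IsometryInvariant.card_mul_integral_le`). -/

open scoped Pointwise in
theorem toSphere_map_linearIsometryEquiv {E : Type*} [NormedAddCommGroup E] [InnerProductSpace ℝ E]
    [FiniteDimensional ℝ E] [MeasurableSpace E] [BorelSpace E] (R : E ≃ₗᵢ[ℝ] E)
    (T : sphere (0 : E) 1 → sphere (0 : E) 1) (hT : ∀ w, (T w : E) = R w) :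
    (volume : Measure E).toSphere.map T = (volume : Measure E).toSphere := by
  have hTc : Continuous T := continuous_induced_rng.2 <| by
    rw [show Subtype.val ∘ T = fun w : sphere (0 : E) 1 => R (w : E) from funext hT]
    fun_prop
  ext s hs
  rw [Measure.map_apply hTc.measurable hs, Measure.toSphere_apply' _ (hTc.measurable hs),
    Measure.toSphere_apply' _ hs]
  congr 1
  -- The surface measure of a set is, up to a factor, the volume of the cone over it. Preimages
  -- under R commute with forming cones, and R preserves volume.
  have h : Ioo (0 : ℝ) 1 • ((↑) '' (T ⁻¹' s) : Set E) =
      R ⁻¹' (Ioo (0 : ℝ) 1 • ((↑) '' s : Set E)) := by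
    ext x
    simp only [Set.mem_smul, mem_preimage, mem_image]
    constructor
    · rintro ⟨c, hc, _, ⟨w, hw, rfl⟩, rfl⟩
      exact ⟨c, hc, _, ⟨T w, hw, rfl⟩, by simp [hT]⟩
    · rintro ⟨c, hc, _, ⟨w, hw, rfl⟩, hx⟩
      refine ⟨c, hc, R.symm w, ⟨⟨R.symm w, by simp⟩, ?_, rfl⟩, ?_⟩
      · have : T ⟨R.symm w, by simp⟩ = w := Subtype.ext (by simp [hT])
        simpa [this] using hw
      · apply R.injective; simpa using hx
  rw [h]
  exact R.measurePreserving.measure_preimage_equiv (f := R.toMeasurableEquiv) _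

/-- No measurability of φ is required, because the isometry restricts to a homeomorphism of the
sphere. -/
theorem integral_uniformSphere_comp_linearIsometryEquiv {dx dy : ℕ}
    (R : PrimalDual dx dy ≃ₗᵢ[ℝ] PrimalDual dx dy) (φ : PrimalDual dx dy → ℝ) :
    ∫ w, φ (R w) ∂(uniformSphere dx dy) = ∫ w, φ w ∂(uniformSphere dx dy) := by
  let T : sphere (0 : PrimalDual dx dy) 1 ≃ₜ sphere (0 : PrimalDual dx dy) 1 :=
    { toFun := fun w => ⟨R w, by simp⟩
      invFun := fun w => ⟨R.symm w, by simp⟩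
      left_inv := fun w => by simp
      right_inv := fun w => by simp
      continuous_toFun := by fun_prop
      continuous_invFun := by fun_prop }
  have h := toSphere_map_linearIsometryEquiv R T (fun _ => rfl)
  simp only [uniformSphere, integral_smul_measure]
  congr 1
  conv_rhs => rw [← h, T.measurableEmbedding.integral_map]
  rfl

theorem integrable_of_continuous {W : Type*} [TopologicalSpace W] [CompactSpace W]
    [MeasurableSpace W] [OpensMeasurableSpace W] {σ : Measure W} [IsFiniteMeasure σ] {F : W → ℝ}
    (hF : Continuous F) : Integrable F σ :=
  hF.integrable_of_hasCompactSupport (.of_compactSpace _)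

theorem hasDerivAt_integral_of_continuousOn {W : Type*} [TopologicalSpace W] [CompactSpace W]
    [MeasurableSpace W] [OpensMeasurableSpace W] (σ : Measure W) [IsFiniteMeasure σ]
    {a b t₀ : ℝ} (ht₀ : t₀ ∈ Ioo a b) (F F' : ℝ → W → ℝ)
    (hF : ∀ t ∈ Ioo a b, Continuous (F t))
    (hF' : ContinuousOn (Function.uncurry F') (Icc a b ×ˢ univ))
    (hd : ∀ t ∈ Ioo a b, ∀ w, HasDerivAt (fun s => F s w) (F' t w) t) :
    HasDerivAt (fun t => ∫ w, F t w ∂σ) (∫ w, F' t₀ w ∂σ) t₀ := by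
  obtain ⟨C, hC⟩ := (isCompact_Icc.prod isCompact_univ).exists_bound_of_continuousOn hF'
  have hnhds : Ioo a b ∈ 𝓝 t₀ := Ioo_mem_nhds ht₀.1 ht₀.2
  have hc : Continuous (F' t₀) := by
    rw [← continuousOn_univ]
    exact hF'.comp (f := fun w => (t₀, w)) (by fun_prop)
      (fun w _ => ⟨Ioo_subset_Icc_self ht₀, mem_univ _⟩)
  refine (hasDerivAt_integral_of_dominated_loc_of_deriv_le (bound := fun _ => C) hnhds
    ?_ ?_ ?_ ?_ ?_ ?_).2
  · filter_upwards [hnhds] with t ht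
    exact (hF t ht).aestronglyMeasurable_of_compactSpace
  · exact integrable_of_continuous (hF t₀ ht₀)
  · exact hc.aestronglyMeasurable_of_compactSpace
  · exact .of_forall fun w t ht => hC (t, w) ⟨Ioo_subset_Icc_self ht, mem_univ _⟩
  · exact integrable_const _
  · exact .of_forall fun w t ht => hd t ht w

theorem HasGradientAt.comp_hasDerivAt_real {E : Type*} [NormedAddCommGroup E]
    [InnerProductSpace ℝ E] [CompleteSpace E] {h : E → ℝ} {g : E} {c : ℝ → E} {c' : E} {t : ℝ}
    (hh : HasGradientAt h g (c t)) (hc : HasDerivAt c c' t) :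
    HasDerivAt (fun s => h (c s)) (inner ℝ g c') t := by
  have := hh.hasFDerivAt.comp_hasDerivAt t hc
  rwa [InnerProductSpace.toDual_apply_apply] at this

theorem HasGradientAt.comp_add_smul {E : Type*} [NormedAddCommGroup E]
    [InnerProductSpace ℝ E] [CompleteSpace E] {h : E → ℝ} {g z x : E} {r : ℝ}
    (hh : HasGradientAt h g (z + r • x)) : HasGradientAt (fun y => h (z + r • y)) (r • g) x := by
  have h1 : HasFDerivAt (fun y : E => z + r • y) (r • ContinuousLinearMap.id ℝ E) x :=
    ((hasFDerivAt_id x).const_smul r).const_add z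
  refine (hh.hasFDerivAt.comp x h1).congr_fderiv ?_
  ext y
  simp

variable {ι : Type*} [Fintype ι] [DecidableEq ι]

/-- The rotation by the angle `t` in the coordinate plane of `i` and `j`. -/
noncomputable def planeRotation {i j : ι} (hij : i ≠ j) (t : ℝ) :
    EuclideanSpace ℝ ι ≃ₗᵢ[ℝ] EuclideanSpace ℝ ι :=
  LinearIsometry.toLinearIsometryEquiv
    { toFun := fun x => x
        + ((Real.cos t - 1) * x i - Real.sin t * x j) • EuclideanSpace.single i (1 : ℝ)
        + (Real.sin t * x i + (Real.cos t - 1) * x j) • EuclideanSpace.single j (1 : ℝ)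
      map_add' := fun x y => by
        simp only [PiLp.add_apply]
        module
      map_smul' := fun c x => by
        simp only [PiLp.smul_apply, smul_eq_mul, RingHom.id_apply]
        module
      norm_map' := fun x => by
        rw [← sq_eq_sq₀ (norm_nonneg _) (norm_nonneg _)]
        simp only [LinearMap.coe_mk, AddHom.coe_mk, norm_add_sq_real, inner_add_left,
          real_inner_smul_right, norm_smul, mul_pow, Real.norm_eq_abs, sq_abs,
          EuclideanSpace.inner_single_right, PiLp.norm_single, norm_one]
        simp [hij.symm]
        linear_combination (x i ^ 2 + x j ^ 2) * Real.sin_sq_add_cos_sq t } rfl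

theorem planeRotation_apply {i j : ι} (hij : i ≠ j) (t : ℝ) (x : EuclideanSpace ℝ ι) :
    planeRotation hij t x = x
        + ((Real.cos t - 1) * x i - Real.sin t * x j) • EuclideanSpace.single i (1 : ℝ)
        + (Real.sin t * x i + (Real.cos t - 1) * x j) • EuclideanSpace.single j (1 : ℝ) :=
  rfl

theorem planeRotation_apply_snd {i j : ι} (hij : i ≠ j) (t : ℝ) (x : EuclideanSpace ℝ ι) :
    planeRotation hij t x j = Real.sin t * x i + Real.cos t * x j := by
  simp [planeRotation_apply, hij.symm]
  ring

/-- Invariance of a measure on the unit sphere under linear isometries, in terms of integrals. -/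
def IsometryInvariant (σ : Measure (sphere (0 : EuclideanSpace ℝ ι) 1)) : Prop :=
  ∀ (R : EuclideanSpace ℝ ι ≃ₗᵢ[ℝ] EuclideanSpace ℝ ι) (φ : EuclideanSpace ℝ ι → ℝ),
    ∫ w, φ (R w) ∂σ = ∫ w, φ w ∂σ

variable {σ : Measure (sphere (0 : EuclideanSpace ℝ ι) 1)} [IsProbabilityMeasure σ]

/-- By invariance the integral of h(R_t w)(R_t w)_j does not depend on the angle t. The identity
says that its derivative at t = 0 vanishes, the velocity of R_t w there being w_i e_j - w_j e_i. -/
theorem IsometryInvariant.integral_mul_coord (hσ : IsometryInvariant σ) {i j : ι} (hij : i ≠ j)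
    {h : EuclideanSpace ℝ ι → ℝ} {g : EuclideanSpace ℝ ι → EuclideanSpace ℝ ι}
    (hh : ∀ x, ‖x‖ = 1 → HasGradientAt h (g x) x) (hg : ContinuousOn g (sphere 0 1)) :
    ∫ w, h w * (w : EuclideanSpace ℝ ι) i ∂σ =
      ∫ w, (w : EuclideanSpace ℝ ι) j * ((w : EuclideanSpace ℝ ι) j * g w i
        - (w : EuclideanSpace ℝ ι) i * g w j) ∂σ := by
  have hcomp : ∀ (c : ℝ → EuclideanSpace ℝ ι) c' t, ‖c t‖ = 1 → HasDerivAt c c' t →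
      HasDerivAt (fun s => h (c s)) (inner ℝ (g (c t)) c') t := fun c c' t h1 hc =>
    (hh _ h1).comp_hasDerivAt_real hc
  have hnorm : ∀ t (w : sphere (0 : EuclideanSpace ℝ ι) 1), ‖planeRotation hij t w‖ = 1 := by simp
  have hcurve : ∀ t (x : EuclideanSpace ℝ ι), HasDerivAt (fun s => planeRotation hij s x)
      ((- Real.sin t * x i - Real.cos t * x j) • EuclideanSpace.single i (1 : ℝ)
        + (Real.cos t * x i - Real.sin t * x j) • EuclideanSpace.single j (1 : ℝ)) t := by
    intro t x
    simp only [planeRotation_apply]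
    have h1 := (((Real.hasDerivAt_cos t).sub_const 1).mul_const (x i)).sub
      ((Real.hasDerivAt_sin t).mul_const (x j))
    have h2 := ((Real.hasDerivAt_sin t).mul_const (x i)).add
      (((Real.hasDerivAt_cos t).sub_const 1).mul_const (x j))
    have := ((h1.smul_const (EuclideanSpace.single i (1 : ℝ))).const_add x).fun_add
      (h2.smul_const (EuclideanSpace.single j (1 : ℝ)))
    refine this.congr_deriv ?_
    module
  have hrot : Continuous fun p : ℝ × sphere (0 : EuclideanSpace ℝ ι) 1 =>
      planeRotation hij p.1 p.2 := by
    simp only [planeRotation_apply]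
    fun_prop
  have hgc : Continuous fun p : ℝ × sphere (0 : EuclideanSpace ℝ ι) 1 =>
      g (planeRotation hij p.1 p.2) :=
    hg.comp_continuous hrot (fun p => by simp)
  have hhc : Continuous fun p : ℝ × sphere (0 : EuclideanSpace ℝ ι) 1 =>
      h (planeRotation hij p.1 p.2) :=
    (HasGradientAt.continuousOn (s := sphere 0 1)
      (fun x hx => hh x (by simpa using hx))).comp_continuous hrot (fun p => by simp)
  have hjc : Continuous fun p : ℝ × sphere (0 : EuclideanSpace ℝ ι) 1 =>
      planeRotation hij p.1 p.2 j := by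
    simp only [planeRotation_apply_snd]
    fun_prop
  have hderiv := hasDerivAt_integral_of_continuousOn σ (a := -1) (b := 1) (t₀ := 0) (by simp)
    (fun t w => h (planeRotation hij t w) * planeRotation hij t w j)
    (fun t w => inner ℝ (g (planeRotation hij t w))
        ((- Real.sin t * w.1 i - Real.cos t * w.1 j) • EuclideanSpace.single i (1 : ℝ)
        + (Real.cos t * w.1 i - Real.sin t * w.1 j) • EuclideanSpace.single j (1 : ℝ))
          * planeRotation hij t w j
        + h (planeRotation hij t w) * (Real.cos t * w.1 i - Real.sin t * w.1 j))
    ?_ ?_ ?_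
  · have hconst : (fun t => ∫ w, h (planeRotation hij t w) * planeRotation hij t w j ∂σ) =
        fun _ => ∫ w, h w * (w : EuclideanSpace ℝ ι) j ∂σ :=
      funext fun t => hσ (planeRotation hij t) (fun x => h x * x j)
    rw [hconst] at hderiv
    have h0 := hderiv.unique (hasDerivAt_const (0 : ℝ) _)
    simp only [planeRotation_apply, Real.sin_zero, Real.cos_zero, sub_self, zero_mul, zero_smul,
      add_zero, neg_zero, one_mul, zero_sub, sub_zero, inner_add_right, real_inner_smul_right,
      EuclideanSpace.inner_single_right, conj_trivial] at h0
    -- h and g are regular only on the sphere; naming their restrictions H and Q as continuous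
    -- functions lets `fun_prop` prove integrability.
    obtain ⟨H, hH⟩ : ∃ H : sphere (0 : EuclideanSpace ℝ ι) 1 → ℝ, ∀ w, h w.1 = H w :=
      ⟨fun w => h w, fun _ => rfl⟩
    obtain ⟨Q, hQ⟩ : ∃ Q : sphere (0 : EuclideanSpace ℝ ι) 1 → EuclideanSpace ℝ ι,
      ∀ w, g w.1 = Q w := ⟨fun w => g w, fun _ => rfl⟩
    have hHc : Continuous H := by
      simpa only [Function.comp_def, hH] using (HasGradientAt.continuousOn (s := sphere 0 1)
        (fun x hx => hh x (by simpa using hx))).comp_continuous continuous_subtype_val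
          fun w : sphere (0 : EuclideanSpace ℝ ι) 1 => w.2
    have hQc : Continuous Q := by
      simpa only [Function.comp_def, hQ] using hg.comp_continuous continuous_subtype_val
        fun w : sphere (0 : EuclideanSpace ℝ ι) 1 => w.2
    simp only [hH, hQ] at h0 ⊢
    rw [← sub_eq_zero, ← integral_sub, ← h0]
    · exact integral_congr_ae (.of_forall fun w => by ring)
    · exact integrable_of_continuous (by fun_prop)
    · exact integrable_of_continuous (by fun_prop)
  · intro t _
    have hc := (hhc.fun_mul hjc).comp (Continuous.prodMk_right t)
    simpa only [Function.comp_def] using hc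
  · refine Continuous.continuousOn ?_
    exact ((hgc.inner (𝕜 := ℝ) (by fun_prop)).fun_mul hjc).fun_add (hhc.fun_mul (by fun_prop))
  · intro t _ w
    have h1 := hcomp (fun s => planeRotation hij s w) _ t (hnorm t w) (hcurve t w)
    have h2 : HasDerivAt (fun s => planeRotation hij s w j)
        (Real.cos t * w.1 i - Real.sin t * w.1 j) t := by
      simp only [planeRotation_apply_snd]
      refine (((Real.hasDerivAt_sin t).mul_const _).fun_add
        ((Real.hasDerivAt_cos t).mul_const _)).congr_deriv ?_
      ring
    exact h1.mul h2

/-- Sum the plane-rotation identities over j ≠ i, using ∑ w_j² = 1, and contract with a. The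
integrand on the right is ⟨a, ·⟩ applied to the tangential part of the gradient. -/
theorem IsometryInvariant.card_sub_one_mul_integral (hσ : IsometryInvariant σ)
    {h : EuclideanSpace ℝ ι → ℝ} {g : EuclideanSpace ℝ ι → EuclideanSpace ℝ ι}
    (hh : ∀ x, ‖x‖ = 1 → HasGradientAt h (g x) x) (hg : ContinuousOn g (sphere 0 1))
    (a : EuclideanSpace ℝ ι) :
    ((Fintype.card ι : ℝ) - 1) * ∫ w, h w * inner ℝ a (w : EuclideanSpace ℝ ι) ∂σ =
      ∫ w, (inner ℝ a (g w) - inner ℝ a (w : EuclideanSpace ℝ ι) * inner ℝ (w : EuclideanSpace ℝ ι)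
        (g w)) ∂σ := by
  have hcoord := fun i j (hij : i ≠ j) => hσ.integral_mul_coord hij hh hg
  obtain ⟨H, hH⟩ : ∃ H : sphere (0 : EuclideanSpace ℝ ι) 1 → ℝ, ∀ w, h w.1 = H w :=
    ⟨fun w => h w, fun _ => rfl⟩
  obtain ⟨Q, hQ⟩ : ∃ Q : sphere (0 : EuclideanSpace ℝ ι) 1 → EuclideanSpace ℝ ι,
    ∀ w, g w.1 = Q w := ⟨fun w => g w, fun _ => rfl⟩
  have hHc : Continuous H := by
    simpa only [Function.comp_def, hH] using (HasGradientAt.continuousOn (s := sphere 0 1)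
      (fun x hx => hh x (by simpa using hx))).comp_continuous continuous_subtype_val
        fun w : sphere (0 : EuclideanSpace ℝ ι) 1 => w.2
  have hQc : Continuous Q := by
    simpa only [Function.comp_def, hQ] using hg.comp_continuous continuous_subtype_val
      fun w : sphere (0 : EuclideanSpace ℝ ι) 1 => w.2
  simp only [hH, hQ] at hcoord ⊢
  clear hh hg hH hQ
  have hcoord' : ∀ i, ((Fintype.card ι : ℝ) - 1) * ∫ w, H w * (w : EuclideanSpace ℝ ι) i ∂σ =
      ∫ w, (Q w i - (w : EuclideanSpace ℝ ι) i * inner ℝ (w : EuclideanSpace ℝ ι) (Q w)) ∂σ := by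
    intro i
    have hcard : ((Finset.univ.erase i).card : ℝ) = (Fintype.card ι : ℝ) - 1 := by
      rw [Finset.card_erase_of_mem (Finset.mem_univ i), Nat.cast_sub, Finset.card_univ, Nat.cast_one]
      exact Finset.card_pos.2 ⟨i, Finset.mem_univ i⟩
    rw [← hcard, ← nsmul_eq_mul, ← Finset.sum_const]
    rw [Finset.sum_congr rfl fun j hj =>
      hcoord i j (Finset.ne_of_mem_erase hj).symm]
    rw [← integral_finsetSum _ fun j _ => integrable_of_continuous (by fun_prop)]
    refine integral_congr_ae (.of_forall fun w => ?_)
    have hw : ∑ j, (w : EuclideanSpace ℝ ι) j * (w : EuclideanSpace ℝ ι) j = 1 := by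
      have := EuclideanSpace.real_norm_sq_eq (w : EuclideanSpace ℝ ι)
      simpa [sq] using this.symm
    have hi : (w : EuclideanSpace ℝ ι) i * ((w : EuclideanSpace ℝ ι) i * Q w i
        - (w : EuclideanSpace ℝ ι) i * Q w i) = 0 := by simp
    beta_reduce
    rw [Finset.sum_erase Finset.univ (f := fun j => (w : EuclideanSpace ℝ ι) j *
      ((w : EuclideanSpace ℝ ι) j * Q w i - (w : EuclideanSpace ℝ ι) i * Q w j)) hi]
    simp only [mul_sub, Finset.sum_sub_distrib, PiLp.inner_apply, Finset.mul_sum, RCLike.inner_apply,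
      conj_trivial]
    congr 1
    · simp only [← mul_assoc, ← Finset.sum_mul, hw, one_mul]
    · exact Finset.sum_congr rfl fun j _ => by ring
  have hsum : ∀ u : EuclideanSpace ℝ ι, inner ℝ a u = ∑ i, a i * u i := fun u => by
    simp [PiLp.inner_apply, mul_comm]
  calc _ = ∑ i, a i * (((Fintype.card ι : ℝ) - 1) * ∫ w, H w * (w : EuclideanSpace ℝ ι) i ∂σ) := by
        simp only [hsum, Finset.mul_sum]
        rw [integral_finsetSum _ fun j _ => integrable_of_continuous (by fun_prop), Finset.mul_sum]
        refine Finset.sum_congr rfl fun i _ => ?_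
        rw [mul_left_comm, ← integral_const_mul (a i)]
        exact congrArg _ (integral_congr_ae (.of_forall fun w => by ring))
    _ = _ := by
        simp only [hcoord', ← integral_const_mul]
        rw [← integral_finsetSum _ fun j _ => integrable_of_continuous (by fun_prop)]
        refine integral_congr_ae (.of_forall fun w => ?_)
        simp only [hsum (Q w), hsum w.1, Finset.sum_mul]
        rw [← Finset.sum_sub_distrib]
        exact Finset.sum_congr rfl fun i _ => by ring

/-- A form of the divergence theorem on the unit ball: the spherical mean of `d • h(w) w` differs
from the gradient of `h` at the origin by at most the oscillation of the gradient. -/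
theorem IsometryInvariant.card_mul_integral_le [Nonempty ι] (hσ : IsometryInvariant σ)
    {h : EuclideanSpace ℝ ι → ℝ} {g : EuclideanSpace ℝ ι → EuclideanSpace ℝ ι}
    (hh : ∀ x ∈ closedBall 0 1, HasGradientAt h (g x) x) (hg : ContinuousOn g (closedBall 0 1))
    (h0 : h 0 = 0) {C : ℝ} (hC : ∀ x ∈ closedBall 0 1, ‖g x - g 0‖ ≤ C)
    (a : EuclideanSpace ℝ ι) :
    (Fintype.card ι : ℝ) * ∫ w, h w * inner ℝ a (w : EuclideanSpace ℝ ι) ∂σ ≤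
      inner ℝ a (g 0) + C * ‖a‖ := by
  obtain ⟨n, hn⟩ : ∃ n, Fintype.card ι = n + 1 := Nat.exists_eq_succ_of_ne_zero Fintype.card_ne_zero
  have hmem : ∀ (t : ℝ) (w : sphere (0 : EuclideanSpace ℝ ι) 1), t ∈ Icc (-1) 1 →
      t • (w : EuclideanSpace ℝ ι) ∈ closedBall (0 : EuclideanSpace ℝ ι) 1 := fun t w ht => by
    simpa [norm_smul, abs_le] using ht
  have hhc : ContinuousOn h (closedBall 0 1) := HasGradientAt.continuousOn hh
  have hscale : ContinuousOn (fun p : ℝ × sphere (0 : EuclideanSpace ℝ ι) 1 =>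
      p.1 • (p.2 : EuclideanSpace ℝ ι)) (Icc (-1) 1 ×ˢ univ) := by fun_prop
  have hhp : ContinuousOn (fun p : ℝ × sphere (0 : EuclideanSpace ℝ ι) 1 =>
      h (p.1 • (p.2 : EuclideanSpace ℝ ι))) (Icc (-1) 1 ×ˢ univ) :=
    hhc.comp hscale fun p hp => hmem _ _ hp.1
  have hgp : ContinuousOn (fun p : ℝ × sphere (0 : EuclideanSpace ℝ ι) 1 =>
      g (p.1 • (p.2 : EuclideanSpace ℝ ι))) (Icc (-1) 1 ×ˢ univ) :=
    hg.comp hscale fun p hp => hmem _ _ hp.1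
  have hht : ∀ t ∈ Icc (-1 : ℝ) 1, Continuous fun w : sphere (0 : EuclideanSpace ℝ ι) 1 =>
      h (t • (w : EuclideanSpace ℝ ι)) := fun t ht =>
    hhc.comp_continuous (by fun_prop) fun w => hmem t w ht
  have hgt : ∀ t ∈ Icc (-1 : ℝ) 1, Continuous fun w : sphere (0 : EuclideanSpace ℝ ι) 1 =>
      g (t • (w : EuclideanSpace ℝ ι)) := fun t ht =>
    hg.comp_continuous (by fun_prop) fun w => hmem t w ht
  have hFc : ContinuousOn (fun p : ℝ × sphere (0 : EuclideanSpace ℝ ι) 1 =>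
      h (p.1 • (p.2 : EuclideanSpace ℝ ι)) * inner ℝ a p.2.1) (Icc (-1) 1 ×ˢ univ) :=
    hhp.fun_mul (by fun_prop)
  -- With n = d - 1, tangential integration by parts on the sphere of radius t evaluates n b(t), and
  -- b' is the radial part. They add up to (tⁿ b)' = tⁿ ∫ ⟨a, g(t w)⟩ ≤ tⁿ K, where K is the claimed
  -- bound; comparing t = 0 with t = 1 gives (n + 1) b(1) ≤ K.
  set b : ℝ → ℝ := fun t => ∫ w, h (t • (w : EuclideanSpace ℝ ι)) * inner ℝ a w.1 ∂σ with hb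
  have hbc : ContinuousOn b (Icc (-1) 1) := by
    obtain ⟨B, hB⟩ := (isCompact_Icc.prod isCompact_univ).exists_bound_of_continuousOn hFc
    refine continuousOn_of_dominated (bound := fun _ => B)
      (fun t ht => ((hht t ht).fun_mul (by fun_prop)).aestronglyMeasurable_of_compactSpace)
      (fun t ht => .of_forall fun w => hB (t, w) ⟨ht, mem_univ _⟩) (integrable_const _)
      (.of_forall fun w => ?_)
    exact hFc.comp (f := fun t => (t, w)) (by fun_prop) fun t ht => ⟨ht, mem_univ _⟩
  have hbd : ∀ t ∈ Ioo (-1 : ℝ) 1, HasDerivAt b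
      (∫ w, inner ℝ (g (t • w.1)) w.1 * inner ℝ a w.1 ∂σ) t := fun t ht => by
    refine hasDerivAt_integral_of_continuousOn σ ht _
      (fun t w => inner ℝ (g (t • w.1)) w.1 * inner ℝ a w.1) ?_ ?_ ?_
    · intro t ht
      exact (hht t (Ioo_subset_Icc_self ht)).fun_mul (by fun_prop)
    · simp only [Function.uncurry_def]
      exact (hgp.inner (𝕜 := ℝ) (by fun_prop)).fun_mul (by fun_prop)
    · intro t ht w
      have hw : HasDerivAt (fun s : ℝ => s • (w : EuclideanSpace ℝ ι)) (w : EuclideanSpace ℝ ι) t := by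
        simpa using (hasDerivAt_id t).smul_const (w : EuclideanSpace ℝ ι)
      exact ((hh _ (hmem t w (Ioo_subset_Icc_self ht))).comp_hasDerivAt_real hw).mul_const _
  have hbt : ∀ t ∈ Ioo (0 : ℝ) 1, (n : ℝ) * b t = t * ∫ w, (inner ℝ a (g (t • w.1))
      - inner ℝ a (w : EuclideanSpace ℝ ι) * inner ℝ (w : EuclideanSpace ℝ ι) (g (t • w.1))) ∂σ := by
    intro t ht
    have hk : ∀ x : EuclideanSpace ℝ ι, ‖x‖ = 1 →
        HasGradientAt (fun y => h (t • y)) (t • g (t • x)) x := fun x hx => by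
      have := (hh (t • x) (hmem t ⟨x, by simpa using hx⟩
        ⟨by linarith [ht.1], ht.2.le⟩))
      rw [← zero_add (t • x)] at this
      simpa using this.comp_add_smul
    have := hσ.card_sub_one_mul_integral hk ((hg.comp (f := fun x => t • x) (by fun_prop)
      fun x hx => hmem t ⟨x, hx⟩ ⟨by linarith [ht.1], ht.2.le⟩).const_smul t) a
    rw [hn] at this
    push_cast at this
    rw [add_sub_cancel_right] at this
    rw [this, ← integral_const_mul]
    refine integral_congr_ae (.of_forall fun w => ?_)
    simp only [real_inner_smul_right]
    ring
  set K := inner ℝ a (g 0) + C * ‖a‖ with hK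
  have hderiv : ∀ t ∈ Ioo (0 : ℝ) 1, ∃ s ≤ 0, HasDerivAt
      (fun t => t ^ n * b t - t ^ (n + 1) / (n + 1) * K) s t := by
    intro t ht
    have ht' : t ∈ Ioo (-1 : ℝ) 1 := ⟨by linarith [ht.1], ht.2⟩
    refine ⟨_, ?_, ((hasDerivAt_pow n t).fun_mul (hbd t ht')).fun_sub
      (((hasDerivAt_pow (n + 1) t).div_const _).mul_const K)⟩
    have hGc := hgt t (Ioo_subset_Icc_self ht')
    have hbt' := hbt t ht
    have hosc : ∀ w : sphere (0 : EuclideanSpace ℝ ι) 1, ‖g (t • w.1) - g 0‖ ≤ C := fun w =>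
      hC _ (hmem t w (Ioo_subset_Icc_self ht'))
    obtain ⟨Q, hQ⟩ : ∃ Q : sphere (0 : EuclideanSpace ℝ ι) 1 → EuclideanSpace ℝ ι,
      ∀ w, g (t • w.1) = Q w := ⟨fun w => g (t • w), fun _ => rfl⟩
    simp only [hQ] at hGc hbt' hosc ⊢
    set T := ∫ w, (inner ℝ a (Q w) - inner ℝ a w.1 * inner ℝ w.1 (Q w)) ∂σ with hT
    -- The truncated exponent at n = 0 is harmless, since the coefficient n vanishes there.
    have h1 : n * t ^ (n - 1) * b t = t ^ n * T := by
      have : t * (n * t ^ (n - 1) * b t) = t * (t ^ n * T) := by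
        rw [mul_left_comm t (t ^ n), ← hbt']
        rcases n with _ | m
        · simp
        · simp [pow_succ]; ring
      exact mul_left_cancel₀ ht.1.ne' this
    have h2 : T + ∫ w, inner ℝ (Q w) w.1 * inner ℝ a w.1 ∂σ ≤ K := by
      rw [hT, ← integral_add (integrable_of_continuous (by fun_prop))
        (integrable_of_continuous (by fun_prop))]
      have : ∫ _w : sphere (0 : EuclideanSpace ℝ ι) 1, K ∂σ = K := by simp
      rw [← this]
      refine integral_mono (integrable_of_continuous (by fun_prop)) (integrable_const _) fun w => ?_
      have h3 := real_inner_le_norm a (Q w - g 0)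
      have h4 : ‖a‖ * ‖Q w - g 0‖ ≤ ‖a‖ * C := by gcongr; exact hosc w
      rw [inner_sub_right] at h3
      simp only [real_inner_comm w.1 (Q w)]
      rw [hK]
      linarith
    rw [h1]
    have h5 : (((n + 1 : ℕ) : ℝ) * t ^ (n + 1 - 1)) / ((n : ℝ) + 1) = t ^ n := by
      push_cast
      field_simp
    rw [h5]
    have := mul_le_mul_of_nonneg_left h2 (pow_nonneg ht.1.le n)
    linarith
  have hanti : AntitoneOn (fun t => t ^ n * b t - t ^ (n + 1) / (n + 1) * K) (Icc 0 1) := by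
    refine antitoneOn_of_deriv_nonpos (convex_Icc 0 1) ?_ ?_ ?_
    · have := hbc.mono (Icc_subset_Icc (by norm_num : (-1 : ℝ) ≤ 0) le_rfl)
      fun_prop
    · rw [interior_Icc]
      intro t ht
      obtain ⟨s, _, hs⟩ := hderiv t ht
      exact hs.differentiableAt.differentiableWithinAt
    · rw [interior_Icc]
      intro t ht
      obtain ⟨s, hs0, hs⟩ := hderiv t ht
      rwa [hs.deriv]
  have hfin := hanti (left_mem_Icc.2 zero_le_one) (right_mem_Icc.2 zero_le_one) zero_le_one
  -- In dimension one tⁿ equals 1 at t = 0, so this endpoint is where the normalization h(0) = 0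
  -- matters.
  have hb0 : b 0 = 0 := by simp [hb, h0]
  have hb1 : b 1 = ∫ w, h w * inner ℝ a (w : EuclideanSpace ℝ ι) ∂σ := by simp [hb]
  simp only [hb0, hb1, one_pow, one_mul, mul_zero, zero_pow (Nat.succ_ne_zero n), zero_div, zero_mul,
    sub_zero, sub_nonpos] at hfin
  rw [hn]
  push_cast
  rw [one_div, inv_mul_eq_div, le_div_iff₀ (by positivity)] at hfin
  linarith

/-- The ball estimate for the linear function ⟨a, ·⟩, whose gradient has no oscillation. -/
theorem IsometryInvariant.integral_inner_sq [Nonempty ι] (hσ : IsometryInvariant σ)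
    (a : EuclideanSpace ℝ ι) :
    (Fintype.card ι : ℝ) * ∫ w, inner ℝ a (w : EuclideanSpace ℝ ι) ^ 2 ∂σ ≤ ‖a‖ ^ 2 := by
  have hgrad : ∀ x, HasGradientAt (fun x => inner ℝ a x) a x := fun x => by
    rw [hasGradientAt_iff_hasFDerivAt]
    exact (InnerProductSpace.toDual ℝ _ a).hasFDerivAt
  have := hσ.card_mul_integral_le (h := fun x => inner ℝ a x) (g := fun _ => a) (C := 0)
    (fun x _ => hgrad x) continuousOn_const (by simp) (by simp) a
  simpa [← sq, real_inner_self_eq_norm_sq] using this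

end Sphere

/-! ### The block structure and the Euclidean projection -/

section Geometry

variable {dx dy : ℕ}

theorem inner_flipDual_left (a b : PrimalDual dx dy) :
    inner ℝ (flipDual a) b = inner ℝ a (flipDual b) := by
  simp [flipDual, concat, xPart, yPart, PiLp.inner_apply]

theorem flipDual_flipDual (a : PrimalDual dx dy) : flipDual (flipDual a) = a := by
  ext i
  rcases i with i | i <;> simp [flipDual, concat, xPart, yPart]

theorem norm_flipDual (a : PrimalDual dx dy) : ‖flipDual a‖ = ‖a‖ := by
  rw [← sq_eq_sq₀ (norm_nonneg _) (norm_nonneg _), ← real_inner_self_eq_norm_sq,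
    inner_flipDual_left, flipDual_flipDual, real_inner_self_eq_norm_sq]

theorem continuous_flipDual : Continuous (flipDual : PrimalDual dx dy → PrimalDual dx dy) := by
  unfold flipDual concat xPart yPart
  refine (PiLp.continuous_toLp 2 _).comp (continuous_pi fun i => ?_)
  rcases i with i | i <;> simp <;> fun_prop

theorem concat_xPart_yPart (z : PrimalDual dx dy) : concat (xPart z) (yPart z) = z := by
  ext i
  rcases i with i | i <;> simp [concat, xPart, yPart]

theorem concat_mem_feasibleSet {X : Set (EuclideanSpace ℝ (Fin dx))}
    {Y : Set (EuclideanSpace ℝ (Fin dy))} {x : EuclideanSpace ℝ (Fin dx)}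
    {y : EuclideanSpace ℝ (Fin dy)} (hx : x ∈ X) (hy : y ∈ Y) : concat x y ∈ feasibleSet X Y :=
  ⟨hx, hy⟩

theorem continuous_concat : Continuous fun p : EuclideanSpace ℝ (Fin dx) × EuclideanSpace ℝ (Fin dy)
    => (concat p.1 p.2 : PrimalDual dx dy) := by
  unfold concat
  refine (PiLp.continuous_toLp 2 _).comp (continuous_pi fun i => ?_)
  rcases i with i | i <;> simp <;> fun_prop

theorem continuous_xPart : Continuous (xPart : PrimalDual dx dy → _) := by
  unfold xPart
  exact (PiLp.continuous_toLp 2 _).comp (continuous_pi fun i => by fun_prop)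

theorem continuous_yPart : Continuous (yPart : PrimalDual dx dy → _) := by
  unfold yPart
  exact (PiLp.continuous_toLp 2 _).comp (continuous_pi fun i => by fun_prop)

variable {Z : Set (PrimalDual dx dy)}

theorem inner_sub_proj_nonpos (hZ : IsCompact Z) (hconv : Convex ℝ Z) (hne : Z.Nonempty)
    (p : PrimalDual dx dy) {z : PrimalDual dx dy} (hz : z ∈ Z) :
    inner ℝ (p - proj Z p) (z - proj Z p) ≤ 0 := by
  obtain ⟨hmem, hmin⟩ := proj_spec hZ hne p
  have : Nonempty Z := hne.to_subtype
  refine (norm_eq_iInf_iff_real_inner_le_zero hconv hmem).1 (le_antisymm ?_ ?_) z hz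
  · exact le_ciInf fun w => hmin w w.2
  · exact ciInf_le (f := fun w : Z => ‖p - w‖) ⟨0, by rintro _ ⟨w, rfl⟩; positivity⟩ ⟨_, hmem⟩

/-- Adding the variational inequalities at the two projections gives firm nonexpansiveness (`h3`);
Cauchy-Schwarz finishes. -/
theorem norm_proj_sub_proj_le (hZ : IsCompact Z) (hconv : Convex ℝ Z) (hne : Z.Nonempty)
    (p q : PrimalDual dx dy) : ‖proj Z p - proj Z q‖ ≤ ‖p - q‖ := by
  have h1 := inner_sub_proj_nonpos hZ hconv hne p (proj_spec hZ hne q).1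
  have h2 := inner_sub_proj_nonpos hZ hconv hne q (proj_spec hZ hne p).1
  set a := proj Z p
  set b := proj Z q
  have h3 : ‖a - b‖ ^ 2 ≤ inner ℝ (p - q) (a - b) := by
    rw [← real_inner_self_eq_norm_sq]
    have : inner ℝ (p - q) (a - b) - inner ℝ (a - b) (a - b)
        = - inner ℝ (p - a) (b - a) - inner ℝ (q - b) (a - b) := by
      simp only [inner_sub_left, inner_sub_right]
      ring
    linarith
  have h4 := real_inner_le_norm (p - q) (a - b)
  by_contra! h
  nlinarith [norm_nonneg (p - q)]

theorem continuous_proj (hZ : IsCompact Z) (hconv : Convex ℝ Z) (hne : Z.Nonempty) :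
    Continuous (proj Z) :=
  (LipschitzWith.of_dist_le_mul (K := 1) fun p q => by
    simpa [dist_eq_norm] using norm_proj_sub_proj_le hZ hconv hne p q).continuous

theorem proj_eq_self (hZ : IsCompact Z) {z : PrimalDual dx dy} (hz : z ∈ Z) : proj Z z = z := by
  have := (proj_spec hZ ⟨z, hz⟩ z).2 z hz
  rw [sub_self, norm_zero, norm_le_zero_iff, sub_eq_zero] at this
  exact this.symm

theorem norm_proj_sub_le (hZ : IsCompact Z) (hconv : Convex ℝ Z) (p : PrimalDual dx dy)
    {z : PrimalDual dx dy} (hz : z ∈ Z) : ‖proj Z p - z‖ ≤ ‖p - z‖ := by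
  simpa [proj_eq_self hZ hz] using norm_proj_sub_proj_le hZ hconv ⟨z, hz⟩ p z

end Geometry

/-! ### The duality gap of a convex-concave function -/

section Gap

variable {dx dy : ℕ} {X : Set (EuclideanSpace ℝ (Fin dx))} {Y : Set (EuclideanSpace ℝ (Fin dy))}
  {f : PrimalDual dx dy → ℝ} {xs : EuclideanSpace ℝ (Fin dx)} {ys : EuclideanSpace ℝ (Fin dy)}

theorem deriv_le_of_forall_sub_le {φ : ℝ → ℝ} {m c : ℝ} (hφ : HasDerivAt φ m 0)
    (h : ∀ t ∈ Set.Ioc (0 : ℝ) 1, φ t - φ 0 ≤ t * c) : m ≤ c := by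
  refine le_of_tendsto hφ.tendsto_slope_zero_right ?_
  filter_upwards [Ioc_mem_nhdsGT (zero_lt_one (α := ℝ))] with t ht
  rw [zero_add, smul_eq_mul, inv_mul_le_iff₀ ht.1]
  exact h t ht

/-- The first-order inequality for f(·, y) towards x* and the one for f(x, ·) towards y* are added;
f(z) cancels. The two displacements combine into the flip of z - z*. -/
theorem dualityGap_le_inner (hx : ∀ y ∈ Y, ConvexOn ℝ X (fun x => f (concat x y)))
    (hy : ∀ x ∈ X, ConcaveOn ℝ Y (fun y => f (concat x y))) (hxs : xs ∈ X) (hys : ys ∈ Y)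
    {z : PrimalDual dx dy} (hz : z ∈ feasibleSet X Y) (hf : DifferentiableAt ℝ f z) :
    dualityGap f xs ys z ≤ inner ℝ (flipDual (gradient f z)) (z - concat xs ys) := by
  have hline : ∀ u, HasDerivAt (fun t : ℝ => f (z + t • u)) (inner ℝ (gradient f z) u) 0 := by
    intro u
    have h1 : HasDerivAt (fun t : ℝ => z + t • u) u 0 := by
      simpa using ((hasDerivAt_id (0 : ℝ)).smul_const u).const_add z
    refine HasGradientAt.comp_hasDerivAt_real ?_ h1
    simpa using hf.hasGradientAt
  have h1 : inner ℝ (gradient f z) (concat xs (yPart z) - z) ≤ f (concat xs (yPart z)) - f z := by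
    refine deriv_le_of_forall_sub_le (hline _) fun t ht => ?_
    have := (hx _ hz.2).2 hz.1 hxs (sub_nonneg.2 ht.2) ht.1.le (by ring)
    have he : z + t • (concat xs (yPart z) - z) =
        concat ((1 - t) • xPart z + t • xs) (yPart z) := by
      ext i
      rcases i with i | i <;> simp [concat, xPart, yPart]
      ring
    simp only [concat_xPart_yPart, smul_eq_mul] at this
    rw [he]
    simp only [zero_smul, add_zero]
    linarith
  have h2 : - inner ℝ (gradient f z) (concat (xPart z) ys - z) ≤
      - (f (concat (xPart z) ys) - f z) := by
    refine deriv_le_of_forall_sub_le (hline _).neg fun t ht => ?_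
    have := (hy _ hz.1).2 hz.2 hys (sub_nonneg.2 ht.2) ht.1.le (by ring)
    have he : z + t • (concat (xPart z) ys - z) =
        concat (xPart z) ((1 - t) • yPart z + t • ys) := by
      ext i
      rcases i with i | i <;> simp [concat, xPart, yPart]
      ring
    simp only [concat_xPart_yPart, smul_eq_mul] at this
    simp only [Pi.neg_apply]
    rw [he]
    simp only [zero_smul, add_zero]
    linarith
  have h3 : flipDual (z - concat xs ys) =
      (concat (xPart z) ys - z) - (concat xs (yPart z) - z) := by
    ext i
    rcases i with i | i <;> simp [concat, xPart, yPart, flipDual]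
  rw [inner_flipDual_left, h3, inner_sub_right, dualityGap]
  linarith

theorem convexOn_dualityGap (hconv : Convex ℝ (feasibleSet X Y))
    (hx : ∀ y ∈ Y, ConvexOn ℝ X (fun x => f (concat x y)))
    (hy : ∀ x ∈ X, ConcaveOn ℝ Y (fun y => f (concat x y))) (hxs : xs ∈ X) (hys : ys ∈ Y) :
    ConvexOn ℝ (feasibleSet X Y) (dualityGap f xs ys) := by
  refine ⟨hconv, fun z hz z' hz' a b ha hb hab => ?_⟩
  have h1 := (hx _ hys).2 hz.1 hz'.1 ha hb hab
  have h2 := (hy _ hxs).2 hz.2 hz'.2 ha hb hab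
  have e1 : xPart (a • z + b • z') = a • xPart z + b • xPart z' := rfl
  have e2 : yPart (a • z + b • z') = a • yPart z + b • yPart z' := rfl
  simp only [dualityGap, e1, e2, smul_eq_mul] at h1 h2 ⊢
  linarith

/-- The points (x, y*) and (x*, y) differ by the flip of z - z*, which has the same norm. -/
theorem dualityGap_le_norm {G : ℝ} (hlip : ∀ z₁ ∈ feasibleSet X Y, ∀ z₂ ∈ feasibleSet X Y,
      |f z₁ - f z₂| ≤ G * ‖z₁ - z₂‖) (hxs : xs ∈ X) (hys : ys ∈ Y)
    {z : PrimalDual dx dy} (hz : z ∈ feasibleSet X Y) :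
    |dualityGap f xs ys z| ≤ G * ‖z - concat xs ys‖ := by
  have h := hlip _ (concat_mem_feasibleSet hz.1 hys) _ (concat_mem_feasibleSet hxs hz.2)
  have h3 : concat (xPart z) ys - concat xs (yPart z) = flipDual (z - concat xs ys) := by
    ext i
    rcases i with i | i <;> simp [concat, xPart, yPart, flipDual]
  rwa [h3, norm_flipDual] at h

end Gap

/-! ### Second moment and bias of the two-point estimator -/

section Estimator

open Metric Set

variable {dx dy : ℕ}

theorem isometryInvariant_uniformSphere : IsometryInvariant (uniformSphere dx dy) :=
  integral_uniformSphere_comp_linearIsometryEquiv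

theorem norm_gradient_le_of_lipschitz {E : Type*} [NormedAddCommGroup E] [InnerProductSpace ℝ E]
    [CompleteSpace E] {f : E → ℝ} {z : E} {r G : ℝ} (hr : 0 < r) (hG : 0 ≤ G)
    (h : ∀ p ∈ closedBall z r, |f p - f z| ≤ G * ‖p - z‖) : ‖gradient f z‖ ≤ G := by
  rw [gradient, LinearIsometryEquiv.norm_map]
  exact norm_fderiv_le_of_lip' ℝ hG
    (Filter.mem_of_superset (closedBall_mem_nhds z hr) fun p hp => h p hp)

variable {f : PrimalDual dx dy → ℝ} {z : PrimalDual dx dy} {r L : ℝ}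

theorem abs_sub_sub_inner_gradient_le (hr : 0 < r)
    (hf : ∀ p ∈ closedBall z r, DifferentiableAt ℝ f p)
    (hL : ∀ p ∈ closedBall z r, ‖gradient f p - gradient f z‖ ≤ L * r)
    {w : PrimalDual dx dy} (hw : ‖w‖ = 1) :
    |f (z + r • w) - f z - r * inner ℝ (gradient f z) w| ≤ L * r * r := by
  have := (convex_closedBall z r).norm_image_sub_le_of_norm_hasFDerivWithin_le'
    (f := f) (f' := fun p => InnerProductSpace.toDual ℝ _ (gradient f p))
    (φ := InnerProductSpace.toDual ℝ _ (gradient f z)) (C := L * r) (x := z) (y := z + r • w)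
    (fun p hp => (hf p hp).hasGradientAt.hasFDerivAt.hasFDerivWithinAt)
    (fun p hp => by rw [← map_sub, LinearIsometryEquiv.norm_map]; exact hL p hp)
    (mem_closedBall_self hr.le) (by simp [norm_smul, hw, abs_of_pos hr])
  simpa [norm_smul, hw, abs_of_pos hr, real_inner_smul_right] using this

theorem norm_gradEst_sq {w : PrimalDual dx dy} (hw : ‖w‖ = 1) :
    ‖gradEst f r z w‖ ^ 2 = ((dx + dy : ℕ) : ℝ) ^ 2 * ((f (z + r • w) - f z) / r) ^ 2 := by
  rw [gradEst, norm_smul, norm_flipDual, hw, mul_one, Real.norm_eq_abs, sq_abs]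
  rw [div_div_eq_mul_div, ← mul_pow]
  ring

theorem integral_norm_gradEst_sq_le [IsProbabilityMeasure (uniformSphere dx dy)]
    [Nonempty (Fin dx ⊕ Fin dy)] {G : ℝ} (hr : 0 < r)
    (hf : ∀ p ∈ closedBall z r, DifferentiableAt ℝ f p)
    (hL : ∀ p ∈ closedBall z r, ‖gradient f p - gradient f z‖ ≤ L * r) (hG : ‖gradient f z‖ ≤ G) :
    ∫ w, ‖gradEst f r z w‖ ^ 2 ∂(uniformSphere dx dy) ≤
      2 * ((dx + dy : ℕ) : ℝ) * G ^ 2 + 2 * ((dx + dy : ℕ) : ℝ) ^ 2 * L ^ 2 * r ^ 2 := by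
  set d : ℝ := ((dx + dy : ℕ) : ℝ) with hd
  have hpt : ∀ w : sphere (0 : PrimalDual dx dy) 1, ‖gradEst f r z w‖ ^ 2 ≤
      2 * d ^ 2 * inner ℝ (gradient f z) w.1 ^ 2 + 2 * d ^ 2 * L ^ 2 * r ^ 2 := by
    intro w
    have hw : ‖w.1‖ = 1 := by simp
    have h := abs_sub_sub_inner_gradient_le hr hf hL hw
    rw [norm_gradEst_sq hw, ← hd]
    set δ := f (z + r • w.1) - f z
    set s : ℝ := inner ℝ (gradient f z) w.1
    have h1 : |δ / r - s| ≤ L * r := by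
      rw [div_sub' hr.ne', abs_div, abs_of_pos hr, div_le_iff₀ hr]
      exact h
    have h2 : (δ / r - s) ^ 2 ≤ (L * r) ^ 2 := sq_le_sq' (abs_le.1 h1).1 (abs_le.1 h1).2
    -- The hint is the exact slack in (δ/r)² ≤ 2s² + 2(δ/r - s)².
    have h3 : (δ / r) ^ 2 ≤ 2 * s ^ 2 + 2 * (L * r) ^ 2 := by nlinarith [sq_nonneg (δ / r - 2 * s)]
    nlinarith [mul_le_mul_of_nonneg_left h3 (sq_nonneg d)]
  have hfc : Continuous fun w : sphere (0 : PrimalDual dx dy) 1 => ‖gradEst f r z w‖ ^ 2 := by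
    have hfw : Continuous fun w : sphere (0 : PrimalDual dx dy) 1 => f (z + r • w.1) :=
      (show ContinuousOn f (closedBall z r) from fun p hp =>
        (hf p hp).continuousAt.continuousWithinAt).comp_continuous (by fun_prop)
        fun w => by simp [norm_smul, abs_of_pos hr]
    simp only [norm_gradEst_sq (norm_eq_of_mem_sphere _)]
    exact continuous_const.mul (((hfw.sub continuous_const).div_const r).pow 2)
  calc _ ≤ ∫ w, (2 * d ^ 2 * inner ℝ (gradient f z) w.1 ^ 2 + 2 * d ^ 2 * L ^ 2 * r ^ 2)
          ∂(uniformSphere dx dy) :=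
        integral_mono (integrable_of_continuous hfc) (integrable_of_continuous (by fun_prop)) hpt
    _ = 2 * d * (d * ∫ w, inner ℝ (gradient f z) w.1 ^ 2 ∂(uniformSphere dx dy))
          + 2 * d ^ 2 * L ^ 2 * r ^ 2 := by
        rw [integral_add (integrable_of_continuous (by fun_prop)) (integrable_const _),
          integral_const_mul]
        simp
        ring
    _ ≤ _ := by
        have h := isometryInvariant_uniformSphere.integral_inner_sq (gradient f z)
        simp only [Fintype.card_sum, Fintype.card_fin] at h
        have h2 : ‖gradient f z‖ ^ 2 ≤ G ^ 2 := by gcongr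
        have : 0 ≤ d := Nat.cast_nonneg _
        gcongr
        exact h.trans h2

theorem inner_gradient_le_integral [IsProbabilityMeasure (uniformSphere dx dy)]
    [Nonempty (Fin dx ⊕ Fin dy)] (hr : 0 < r)
    (hf : ∀ p ∈ closedBall z r, DifferentiableAt ℝ f p)
    (hc : ContinuousOn (gradient f) (closedBall z r))
    (hL : ∀ p ∈ closedBall z r, ‖gradient f p - gradient f z‖ ≤ L * r) (a : PrimalDual dx dy) :
    inner ℝ (flipDual (gradient f z)) a ≤
      ∫ w, inner ℝ (gradEst f r z w) a ∂(uniformSphere dx dy) + L * r * ‖a‖ := by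
  have hmem : ∀ x ∈ closedBall (0 : PrimalDual dx dy) 1, z + r • x ∈ closedBall z r := by
    intro x hx
    simp only [mem_closedBall, dist_zero_right, dist_self_add_left, norm_smul, Real.norm_eq_abs,
      abs_of_pos hr] at hx ⊢
    nlinarith
  -- The ball estimate is one-sided; testing it against -ã turns its upper bound into the lower
  -- bound wanted for the estimator. Rescaling the ball of radius r to the unit ball multiplies the
  -- gradient, and so its oscillation L r, by r.
  have h := isometryInvariant_uniformSphere.card_mul_integral_le
    (h := fun x => f (z + r • x) - f z) (g := fun x => r • gradient f (z + r • x)) (C := r * (L * r))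
    (fun x hx => by
      have := ((hf _ (hmem x hx)).hasGradientAt.comp_add_smul (x := x) (r := r))
      rw [hasGradientAt_iff_hasFDerivAt] at this ⊢
      exact this.sub_const _)
    ((hc.comp (by fun_prop) hmem).const_smul r) (by simp)
    (fun x hx => by
      simp only [← smul_sub, norm_smul, Real.norm_eq_abs, abs_of_pos hr, smul_zero, add_zero]
      gcongr
      exact hL _ (hmem x hx)) (- flipDual a)
  have he : ∫ w, inner ℝ (gradEst f r z w) a ∂(uniformSphere dx dy) =
      - (((dx + dy : ℕ) : ℝ) * ∫ w, (f (z + r • w.1) - f z) * inner ℝ (-flipDual a) w.1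
        ∂(uniformSphere dx dy)) / r := by
    rw [← integral_const_mul, ← integral_neg, ← integral_div]
    refine integral_congr_ae (.of_forall fun w => ?_)
    simp only [gradEst, real_inner_smul_left, inner_flipDual_left w.1, inner_neg_left,
      real_inner_comm (flipDual a) w.1]
    field_simp
  simp only [Fintype.card_sum, Fintype.card_fin, smul_zero, add_zero, inner_neg_left, norm_neg,
    norm_flipDual, real_inner_smul_right] at h he
  rw [he, inner_flipDual_left, real_inner_comm, ← sub_le_iff_le_add, le_div_iff₀ hr]
  linarith

end Estimator

/-! ### One extra-gradient step; measurability and independence of the iterates -/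

section Stochastic

open Metric Set

theorem integrable_comp_of_isCompact {Ω T : Type*} [MeasurableSpace Ω] {μ : Measure Ω}
    [IsFiniteMeasure μ] [TopologicalSpace T] [MeasurableSpace T] [OpensMeasurableSpace T]
    {S : Set T} (hS : IsCompact S) {ψ : T → ℝ} (hψ : Continuous ψ) {A : Ω → T} (hA : Measurable A)
    (hAS : ∀ ω, A ω ∈ S) : Integrable (fun ω => ψ (A ω)) μ := by
  obtain ⟨B, hB⟩ := hS.exists_bound_of_continuousOn hψ.continuousOn
  exact Integrable.of_bound (hψ.measurable.comp hA).aestronglyMeasurable B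
    (.of_forall fun ω => hB _ (hAS ω))

theorem integrable_comp_prod_of_isCompact {Ω T W : Type*} [MeasurableSpace Ω] {μ : Measure Ω}
    [IsFiniteMeasure μ] [TopologicalSpace T] [SecondCountableTopology T]
    [MeasurableSpace T] [BorelSpace T] [TopologicalSpace W] [CompactSpace W]
    [SecondCountableTopology W] [MeasurableSpace W] [BorelSpace W]
    {S : Set T} (hS : IsCompact S) {ψ : T × W → ℝ} (hψ : Continuous ψ) {A : Ω → T} {B : Ω → W}
    (hA : Measurable A) (hB : Measurable B) (hAS : ∀ ω, A ω ∈ S) :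
    Integrable (fun ω => ψ (A ω, B ω)) μ :=
  integrable_comp_of_isCompact (hS.prod isCompact_univ) hψ (hA.prodMk hB)
    fun ω => ⟨hAS ω, mem_univ _⟩

/-- A bound on the mean of `ψ z ·` that is uniform over `z ∈ S` bounds the mean of `ψ A B` when
`A ∈ S` is independent of `B`. -/
theorem ProbabilityTheory.IndepFun.integral_le {Ω T W : Type*} [MeasurableSpace Ω] {μ : Measure Ω}
    [IsProbabilityMeasure μ] [TopologicalSpace T] [SecondCountableTopology T] [T2Space T]
    [MeasurableSpace T] [BorelSpace T] [TopologicalSpace W] [CompactSpace W]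
    [SecondCountableTopology W] [MeasurableSpace W] [BorelSpace W]
    {A : Ω → T} {B : Ω → W} (hind : IndepFun A B μ) (hA : Measurable A) (hB : Measurable B)
    {S : Set T} (hS : IsCompact S) (hAS : ∀ ω, A ω ∈ S)
    {ψ : T × W → ℝ} (hψ : Continuous ψ) {c : ℝ} (h : ∀ z ∈ S, ∫ w, ψ (z, w) ∂(μ.map B) ≤ c) :
    ∫ ω, ψ (A ω, B ω) ∂μ ≤ c := by
  have hAB : Measurable fun ω => (A ω, B ω) := hA.prodMk hB
  have := Measure.isProbabilityMeasure_map (μ := μ) hA.aemeasurable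
  have := Measure.isProbabilityMeasure_map (μ := μ) hB.aemeasurable
  have hint : Integrable ψ (μ.map fun ω => (A ω, B ω)) := by
    rw [integrable_map_measure hψ.aestronglyMeasurable hAB.aemeasurable]
    exact integrable_comp_prod_of_isCompact hS hψ hA hB hAS
  rw [← integral_map (f := ψ) hAB.aemeasurable hψ.aestronglyMeasurable]
  rw [hind.map_prod_eq_prod_map_map hA.aemeasurable hB.aemeasurable] at hint ⊢
  rw [integral_prod _ hint]
  have hc : ∫ _z, c ∂(μ.map A) = c := by simp
  rw [← hc]
  refine integral_mono_ae hint.integral_prod_left (integrable_const _) ?_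
  rw [Filter.EventuallyLE, ae_map_iff hA.aemeasurable]
  · exact .of_forall fun ω => h _ (hAS ω)
  · exact measurableSet_le (hψ.stronglyMeasurable.integral_prod_right').measurable measurable_const

variable {dx dy : ℕ} {Z : Set (PrimalDual dx dy)} {f : PrimalDual dx dy → ℝ}

/-- Nonexpansiveness towards z* handles ⟨g⁺, z - z*⟩; the rest, ⟨g⁺, z⁺ - z⟩, is at most η‖g⁺‖‖g‖
because the midpoint moves by at most η‖g‖. Then 2‖g⁺‖‖g‖ ≤ ‖g⁺‖² + ‖g‖². -/
theorem extragradient_step_le (hZ : IsCompact Z) (hconv : Convex ℝ Z) {z zs : PrimalDual dx dy}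
    (hz : z ∈ Z) (hzs : zs ∈ Z) {η : ℝ} (hη : 0 < η) (g gp : PrimalDual dx dy) :
    2 * η * inner ℝ gp (proj Z (z - η • g) - zs) ≤
      ‖z - zs‖ ^ 2 - ‖proj Z (z - η • gp) - zs‖ ^ 2 + η ^ 2 * (2 * ‖gp‖ ^ 2 + ‖g‖ ^ 2) := by
  have h1 := norm_proj_sub_le hZ hconv (z - η • gp) hzs
  have h2 : ‖proj Z (z - η • g) - z‖ ≤ η * ‖g‖ := by
    simpa [norm_smul, abs_of_pos hη] using norm_proj_sub_le hZ hconv (z - η • g) hz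
  have h3 : ‖proj Z (z - η • gp) - zs‖ ^ 2 ≤
      ‖z - zs‖ ^ 2 - 2 * η * inner ℝ gp (z - zs) + η ^ 2 * ‖gp‖ ^ 2 := by
    have h4 := norm_sub_sq_real (z - zs) (η • gp)
    rw [real_inner_smul_right, norm_smul, mul_pow, Real.norm_eq_abs, sq_abs,
      real_inner_comm] at h4
    rw [sub_right_comm] at h1
    have := pow_le_pow_left₀ (norm_nonneg _) h1 2
    linarith
  have h5 : inner ℝ gp (proj Z (z - η • g) - z) ≤ ‖gp‖ * (η * ‖g‖) :=
    (real_inner_le_norm _ _).trans (by gcongr)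
  have h6 : inner ℝ gp (proj Z (z - η • g) - zs) =
      inner ℝ gp (proj Z (z - η • g) - z) + inner ℝ gp (z - zs) := by
    rw [← inner_add_right]
    congr 1
    abel
  rw [h6]
  nlinarith [mul_le_mul_of_nonneg_left h5 hη.le, mul_nonneg (sq_nonneg η)
    (sq_nonneg (‖gp‖ - ‖g‖))]

theorem continuous_gradEst (hf : Continuous f) (r : ℝ) :
    Continuous fun p : PrimalDual dx dy × sphere (0 : PrimalDual dx dy) 1 =>
      gradEst f r p.1 p.2 := by
  have := continuous_flipDual (dx := dx) (dy := dy)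
  unfold gradEst
  fun_prop

theorem zoegIter_mem (hZ : IsCompact Z) (η : ℝ) (r : ℕ → ℝ) {z₀ : PrimalDual dx dy} (hz₀ : z₀ ∈ Z)
    (v w : ℕ → PrimalDual dx dy) (k : ℕ) : zoegIter f Z η r z₀ v w k ∈ Z := by
  cases k with
  | zero => exact hz₀
  | succ k => exact (proj_spec hZ ⟨z₀, hz₀⟩ _).1

theorem zoegMid_mem (hZ : IsCompact Z) (hne : Z.Nonempty) (η : ℝ) (r : ℕ → ℝ)
    (z₀ : PrimalDual dx dy) (v w : ℕ → PrimalDual dx dy) (k : ℕ) :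
    zoegMid f Z η r z₀ v w k ∈ Z :=
  (proj_spec hZ hne _).1

theorem zoegOutput_mem (hZ : IsCompact Z) (hconv : Convex ℝ Z) (hne : Z.Nonempty) (η : ℝ)
    (r : ℕ → ℝ) (z₀ : PrimalDual dx dy) (v w : ℕ → PrimalDual dx dy) {K : ℕ} (hK : 0 < K) :
    zoegOutput f Z η r z₀ v w K ∈ Z := by
  rw [zoegOutput, Finset.smul_sum]
  refine hconv.sum_mem (fun _ _ => by positivity) ?_ fun k _ => zoegMid_mem hZ hne η r z₀ v w k
  simp [hK.ne']

variable {f' : PrimalDual dx dy → ℝ} {r : ℕ → ℝ}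

/-- Allows f, uncontrolled away from the query region, to be replaced by a globally continuous
function without changing the trajectory. -/
theorem zoegIter_congr (hZ : IsCompact Z) (hff : ∀ k, ∀ z ∈ Z, ∀ u, ‖u‖ = 1 →
      gradEst f (r k) z u = gradEst f' (r k) z u) (η : ℝ) {z₀ : PrimalDual dx dy} (hz₀ : z₀ ∈ Z)
    {v w : ℕ → PrimalDual dx dy} (hv : ∀ k, ‖v k‖ = 1) (hw : ∀ k, ‖w k‖ = 1) (k : ℕ) :
    zoegIter f Z η r z₀ v w k = zoegIter f' Z η r z₀ v w k := by
  induction k with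
  | zero => rfl
  | succ k ih =>
    simp only [zoegIter, midPoint]
    rw [ih, hff k _ (zoegIter_mem hZ η r hz₀ v w k) _ (hv k),
      hff k _ (proj_spec hZ ⟨z₀, hz₀⟩ _).1 _ (hw k)]

theorem zoegMid_congr (hZ : IsCompact Z) (hff : ∀ k, ∀ z ∈ Z, ∀ u, ‖u‖ = 1 →
      gradEst f (r k) z u = gradEst f' (r k) z u) (η : ℝ) {z₀ : PrimalDual dx dy} (hz₀ : z₀ ∈ Z)
    {v w : ℕ → PrimalDual dx dy} (hv : ∀ k, ‖v k‖ = 1) (hw : ∀ k, ‖w k‖ = 1) (k : ℕ) :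
    zoegMid f Z η r z₀ v w k = zoegMid f' Z η r z₀ v w k := by
  rw [zoegMid, zoegMid, midPoint, midPoint, zoegIter_congr hZ hff η hz₀ hv hw,
    hff k _ (zoegIter_mem hZ η r hz₀ v w k) _ (hv k)]

variable {Ω : Type*} {v w : ℕ → Ω → sphere (0 : PrimalDual dx dy) 1}

theorem Continuous.measurable_proj_sub_gradEst {m : MeasurableSpace Ω} (hf : Continuous f)
    (hZ : IsCompact Z) (hconv : Convex ℝ Z) (hne : Z.Nonempty) (η s : ℝ)
    {A C : Ω → PrimalDual dx dy} {B : Ω → sphere (0 : PrimalDual dx dy) 1} (hC : Measurable C)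
    (hA : Measurable A) (hB : Measurable B) :
    Measurable fun ω => proj Z (C ω - η • gradEst f s (A ω) (B ω)) := by
  have hg : Measurable ((fun p : PrimalDual dx dy × sphere (0 : PrimalDual dx dy) 1 =>
      gradEst f s p.1 p.2) ∘ fun ω => (A ω, B ω)) :=
    (continuous_gradEst hf s).measurable.comp (hA.prodMk hB)
  simp only [Function.comp_def] at hg
  have hp : Measurable (proj Z ∘ fun ω => C ω - η • gradEst f s (A ω) (B ω)) :=
    (continuous_proj hZ hconv hne).measurable.comp (hC.sub (hg.const_smul η))
  simpa only [Function.comp_def] using hp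

/-- The σ-algebra generated by the directions `v i` and `w j` with indices in `I`. -/
@[reducible]
def directionsIn (v w : ℕ → Ω → sphere (0 : PrimalDual dx dy) 1) (I : Set (ℕ ⊕ ℕ)) :
    MeasurableSpace Ω :=
  ⨆ i ∈ I, MeasurableSpace.comap (Sum.elim v w i) inferInstance

/-- The indices of the directions drawn before iteration `k`. -/
def indicesBefore (k : ℕ) : Set (ℕ ⊕ ℕ) := {i | Sum.elim id id i < k}

theorem measurable_directionsIn {I : Set (ℕ ⊕ ℕ)} {i : ℕ ⊕ ℕ} (hi : i ∈ I) :
    Measurable[directionsIn v w I] (Sum.elim v w i) :=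
  Measurable.mono (comap_measurable _)
    (le_iSup₂_of_le (f := fun i _ => MeasurableSpace.comap (Sum.elim v w i) inferInstance)
      i hi le_rfl) le_rfl

theorem directionsIn_mono {I J : Set (ℕ ⊕ ℕ)} (h : I ⊆ J) :
    directionsIn v w I ≤ directionsIn v w J :=
  biSup_mono h

/-- The index set contains v_k but not w_k: this is what later makes the midpoint independent of
w_k. -/
theorem measurable_zoegMid_of_zoegIter (hZ : IsCompact Z) (hconv : Convex ℝ Z) (hne : Z.Nonempty)
    (hf : Continuous f) (η : ℝ) (z₀ : PrimalDual dx dy) {k : ℕ}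
    (h : Measurable[directionsIn v w (indicesBefore k)]
      fun ω => zoegIter f Z η r z₀ (fun k => v k ω) (fun k => w k ω) k) :
    Measurable[directionsIn v w (insert (.inl k) (indicesBefore k))]
      fun ω => zoegMid f Z η r z₀ (fun k => v k ω) (fun k => w k ω) k := by
  have hz := h.mono (directionsIn_mono (subset_insert (.inl k) _)) le_rfl
  have hv : Measurable[directionsIn v w (insert (.inl k) (indicesBefore k))] (v k) :=
    measurable_directionsIn (v := v) (w := w) (i := .inl k) (mem_insert _ _)
  simp only [zoegMid, midPoint]
  exact hf.measurable_proj_sub_gradEst hZ hconv hne η (r k) hz hz hv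

theorem measurable_zoegIter (hZ : IsCompact Z) (hconv : Convex ℝ Z) (hne : Z.Nonempty)
    (hf : Continuous f) (η : ℝ) (z₀ : PrimalDual dx dy) (k : ℕ) :
    Measurable[directionsIn v w (indicesBefore k)]
      fun ω => zoegIter f Z η r z₀ (fun k => v k ω) (fun k => w k ω) k := by
  induction k with
  | zero => exact measurable_const
  | succ k ih =>
    have hsub : indicesBefore k ⊆ indicesBefore (k + 1) := fun i hi => Nat.lt_succ_of_lt hi
    have hz := ih.mono (directionsIn_mono hsub) le_rfl
    have hm := (measurable_zoegMid_of_zoegIter hZ hconv hne hf η z₀ ih).mono (directionsIn_mono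
      (insert_subset (show Sum.inl k ∈ indicesBefore (k + 1) from Nat.lt_succ_self k) hsub)) le_rfl
    have hw : Measurable[directionsIn v w (indicesBefore (k + 1))] (w k) :=
      measurable_directionsIn (v := v) (w := w) (i := .inr k) (Nat.lt_succ_self k)
    simp only [zoegIter]
    exact hf.measurable_proj_sub_gradEst hZ hconv hne η (r k) hz hm hw

theorem measurable_zoegMid (hZ : IsCompact Z) (hconv : Convex ℝ Z) (hne : Z.Nonempty)
    (hf : Continuous f) (η : ℝ) (z₀ : PrimalDual dx dy) (k : ℕ) :
    Measurable[directionsIn v w (insert (.inl k) (indicesBefore k))]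
      fun ω => zoegMid f Z η r z₀ (fun k => v k ω) (fun k => w k ω) k :=
  measurable_zoegMid_of_zoegIter hZ hconv hne hf η z₀ (measurable_zoegIter hZ hconv hne hf η z₀ k)

variable [mΩ : MeasurableSpace Ω] {μ : Measure Ω}

theorem directionsIn_le (hv : ∀ k, Measurable (v k)) (hw : ∀ k, Measurable (w k))
    (I : Set (ℕ ⊕ ℕ)) : directionsIn v w I ≤ mΩ :=
  iSup₂_le fun i _ => by
    rcases i with i | i
    · exact (hv i).comap_le
    · exact (hw i).comap_le

/-- Mutual independence makes the σ-algebras generated by disjoint families of directions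
independent. -/
theorem indepFun_of_measurable_directionsIn (hv : ∀ k, Measurable (v k))
    (hw : ∀ k, Measurable (w k)) (hindep : iIndepFun (Sum.elim v w) μ) {I : Set (ℕ ⊕ ℕ)}
    {A : Ω → PrimalDual dx dy} (hA : Measurable[directionsIn v w I] A) {i : ℕ ⊕ ℕ} (hi : i ∉ I) :
    IndepFun A (Sum.elim v w i) μ := by
  have hle : ∀ j, MeasurableSpace.comap (Sum.elim v w j) inferInstance ≤ mΩ := by
    rintro (j | j)
    · exact (hv j).comap_le
    · exact (hw j).comap_le
  have := indep_iSup_of_disjoint hle hindep (disjoint_singleton_right.2 hi)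
  simp only [mem_singleton_iff, iSup_iSup_eq_left] at this
  exact indep_of_indep_of_le_left this hA.comap_le

end Stochastic

/-! ### The expected step inequality and its telescoping -/

section Convergence

open Metric Set

variable {dx dy : ℕ} {Z : Set (PrimalDual dx dy)} {f : PrimalDual dx dy → ℝ} {r : ℕ → ℝ}
  {Ω : Type*} [MeasurableSpace Ω] {μ : Measure Ω}
  {v w : ℕ → Ω → sphere (0 : PrimalDual dx dy) 1}

/-- Integrates the step inequality, with a the gap at the midpoint, b = ⟨g⁺, z⁺ - z*⟩, q and q' the
squared distances before and after the step, and n and n' the squared norms of g⁺ and g. -/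
theorem two_mul_integral_le {a b q q' n n' : Ω → ℝ} {η V β : ℝ} (hη : 0 < η)
    (ha : Integrable a μ) (hab : Integrable (fun ω => a ω - b ω) μ) (hq : Integrable q μ)
    (hq' : Integrable q' μ) (hn : Integrable n μ) (hn' : Integrable n' μ)
    (h : ∀ ω, 2 * η * b ω ≤ q ω - q' ω + η ^ 2 * (2 * n ω + n' ω))
    (hβ : ∫ ω, (a ω - b ω) ∂μ ≤ β) (hV : ∫ ω, n ω ∂μ ≤ V) (hV' : ∫ ω, n' ω ∂μ ≤ V) :
    2 * η * ∫ ω, a ω ∂μ ≤ ∫ ω, q ω ∂μ - ∫ ω, q' ω ∂μ + 3 * η ^ 2 * V + 2 * η * β := by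
  have i1 : Integrable (fun ω => q ω - q' ω) μ := hq.sub hq'
  have i2 : Integrable (fun ω => η ^ 2 * 2 * n ω + η ^ 2 * n' ω) μ :=
    (hn.const_mul _).add (hn'.const_mul _)
  have i3 : Integrable (fun ω => q ω - q' ω + (η ^ 2 * 2 * n ω + η ^ 2 * n' ω)) μ := i1.add i2
  have hint : ∫ ω, 2 * η * a ω ∂μ ≤ ∫ ω, (2 * η * (a ω - b ω)
      + (q ω - q' ω + (η ^ 2 * 2 * n ω + η ^ 2 * n' ω))) ∂μ := by
    refine integral_mono (ha.const_mul _) ((hab.const_mul _).add i3) fun ω => ?_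
    have := h ω
    simp only
    linarith
  rw [integral_const_mul, integral_add (hab.const_mul _) i3, integral_add i1 i2,
    integral_sub hq hq', integral_add (hn.const_mul _) (hn'.const_mul _), integral_const_mul,
    integral_const_mul, integral_const_mul] at hint
  have e1 := mul_le_mul_of_nonneg_left hV (sq_nonneg η)
  have e2 := mul_le_mul_of_nonneg_left hV' (sq_nonneg η)
  have e3 := mul_le_mul_of_nonneg_left hβ hη.le
  linarith

variable [IsProbabilityMeasure μ]

theorem integral_zoegMid_step_le (hZ : IsCompact Z) (hconv : Convex ℝ Z) (hf : Continuous f)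
    {φ : PrimalDual dx dy → ℝ} (hφ : Continuous φ) {z₀ zs : PrimalDual dx dy} (hz₀ : z₀ ∈ Z)
    (hzs : zs ∈ Z) {η : ℝ} (hη : 0 < η)
    (hv : ∀ k, Measurable (v k)) (hw : ∀ k, Measurable (w k))
    (hv_law : ∀ k, μ.map (v k) = uniformSphere dx dy)
    (hw_law : ∀ k, μ.map (w k) = uniformSphere dx dy)
    (hindep : iIndepFun (Sum.elim v w) μ) {k : ℕ} {V β : ℝ}
    (hV : ∀ z ∈ Z, ∫ u, ‖gradEst f (r k) z u‖ ^ 2 ∂(uniformSphere dx dy) ≤ V)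
    (hβ : ∀ z ∈ Z, φ z ≤ ∫ u, inner ℝ (gradEst f (r k) z u) (z - zs) ∂(uniformSphere dx dy) + β) :
    2 * η * ∫ ω, φ (zoegMid f Z η r z₀ (fun k => v k ω) (fun k => w k ω) k) ∂μ ≤
      ∫ ω, ‖zoegIter f Z η r z₀ (fun k => v k ω) (fun k => w k ω) k - zs‖ ^ 2 ∂μ
      - ∫ ω, ‖zoegIter f Z η r z₀ (fun k => v k ω) (fun k => w k ω) (k + 1) - zs‖ ^ 2 ∂μ
      + 3 * η ^ 2 * V + 2 * η * β := by
  have hne : Z.Nonempty := ⟨z₀, hz₀⟩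
  have : IsProbabilityMeasure (uniformSphere dx dy) := by
    rw [← hv_law 0]
    exact Measure.isProbabilityMeasure_map (hv 0).aemeasurable
  have hstep : ∀ ω, _ := fun ω => extragradient_step_le hZ hconv
    (zoegIter_mem (f := f) hZ η r hz₀ (fun k => v k ω) (fun k => w k ω) k) hzs hη
    (gradEst f (r k) (zoegIter f Z η r z₀ (fun k => v k ω) (fun k => w k ω) k) (v k ω))
    (gradEst f (r k) (zoegMid f Z η r z₀ (fun k => v k ω) (fun k => w k ω) k) (w k ω))
  change ∀ ω, 2 * η * inner ℝ _ (zoegMid f Z η r z₀ (fun k => v k ω) (fun k => w k ω) k - zs) ≤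
    _ - ‖zoegIter f Z η r z₀ (fun k => v k ω) (fun k => w k ω) (k + 1) - zs‖ ^ 2 + _ at hstep
  have mI := fun k => measurable_zoegIter (r := r) (v := v) (w := w) hZ hconv hne hf η z₀ k
  have mM := measurable_zoegMid (r := r) (v := v) (w := w) hZ hconv hne hf η z₀ k
  have iI : IndepFun _ (v k) μ := indepFun_of_measurable_directionsIn hv hw hindep (mI k)
    (i := .inl k) (fun h => lt_irrefl k h)
  have iM : IndepFun _ (w k) μ := indepFun_of_measurable_directionsIn hv hw hindep mM
    (i := .inr k) (fun h => by
      rcases h with h | h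
      · simp at h
      · exact lt_irrefl k h)
  have mI' := fun k => (mI k).mono (directionsIn_le hv hw _) le_rfl
  have mM' := mM.mono (directionsIn_le hv hw _) le_rfl
  have memI : ∀ k ω, _ := fun k ω => zoegIter_mem (f := f) hZ η r hz₀ (fun k => v k ω)
    (fun k => w k ω) k
  have memM : ∀ ω, _ := fun ω => zoegMid_mem (f := f) hZ hne η r z₀ (fun k => v k ω)
    (fun k => w k ω) k
  clear mI mM
  obtain ⟨B, hB⟩ : ∃ B : Ω → PrimalDual dx dy, ∀ ω,
    -- From here on the trajectory enters only through membership in Z, measurability, independence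
    -- and the step inequality, so it is made opaque.
    zoegMid f Z η r z₀ (fun k => v k ω) (fun k => w k ω) k = B ω := ⟨_, fun _ => rfl⟩
  obtain ⟨A, hA⟩ : ∃ A : ℕ → Ω → PrimalDual dx dy, ∀ k ω,
    zoegIter f Z η r z₀ (fun k => v k ω) (fun k => w k ω) k = A k ω := ⟨_, fun _ _ => rfl⟩
  simp only [hA, hB] at hstep iI iM mI' mM' memI memM ⊢
  have hG := continuous_gradEst hf (r k)
  have hψ : Continuous fun p : PrimalDual dx dy × sphere (0 : PrimalDual dx dy) 1 =>
      φ p.1 - inner ℝ (gradEst f (r k) p.1 p.2) (p.1 - zs) :=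
    (hφ.comp continuous_fst).sub (hG.inner (𝕜 := ℝ) (by fun_prop))
  have hN : Continuous fun p : PrimalDual dx dy × sphere (0 : PrimalDual dx dy) 1 =>
      ‖gradEst f (r k) p.1 p.2‖ ^ 2 := by fun_prop
  have b1 : ∫ ω, ‖gradEst f (r k) (A k ω) (v k ω)‖ ^ 2 ∂μ ≤ V :=
    iI.integral_le (mI' k) (hv k) hZ (memI k) hN fun z hz => by rw [hv_law]; exact hV z hz
  have b2 : ∫ ω, ‖gradEst f (r k) (B ω) (w k ω)‖ ^ 2 ∂μ ≤ V :=
    iM.integral_le mM' (hw k) hZ memM hN fun z hz => by rw [hw_law]; exact hV z hz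
  have b3 : ∫ ω, (φ (B ω) - inner ℝ (gradEst f (r k) (B ω) (w k ω)) (B ω - zs)) ∂μ ≤ β := by
    refine iM.integral_le mM' (hw k) hZ memM hψ fun z hz => ?_
    have hc : Continuous fun u : sphere (0 : PrimalDual dx dy) 1 =>
        inner ℝ (gradEst f (r k) z u) (z - zs) := by
      have h := hG.comp (Continuous.prodMk_right z)
      simp only [Function.comp_def] at h
      exact h.inner continuous_const
    dsimp only
    rw [hw_law, integral_sub (integrable_const _) (integrable_of_continuous hc)]
    simp only [integral_const, probReal_univ, one_smul]
    linarith [hβ z hz]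
  have i1 : Integrable (fun ω => ‖gradEst f (r k) (A k ω) (v k ω)‖ ^ 2) μ :=
    integrable_comp_prod_of_isCompact hZ hN (mI' k) (hv k) (memI k)
  have i2 : Integrable (fun ω => ‖gradEst f (r k) (B ω) (w k ω)‖ ^ 2) μ :=
    integrable_comp_prod_of_isCompact hZ hN mM' (hw k) memM
  have i3 : Integrable (fun ω => φ (B ω) - inner ℝ (gradEst f (r k) (B ω) (w k ω)) (B ω - zs)) μ :=
    integrable_comp_prod_of_isCompact hZ hψ mM' (hw k) memM
  have i4 : ∀ k, Integrable (fun ω => ‖A k ω - zs‖ ^ 2) μ := fun k =>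
    integrable_comp_of_isCompact hZ (ψ := fun z => ‖z - zs‖ ^ 2) (by fun_prop) (mI' k) (memI k)
  have i5 : Integrable (fun ω => φ (B ω)) μ := integrable_comp_of_isCompact hZ hφ mM' memM
  exact two_mul_integral_le hη i5 i3 (i4 k) (i4 (k + 1)) i2 i1 hstep b3 b2 b1

/-- The telescoped bound for the iterations after the first one. -/
theorem sum_integral_zoegMid_le (hZ : IsCompact Z) (hconv : Convex ℝ Z) (hf : Continuous f)
    {φ : PrimalDual dx dy → ℝ} (hφ : Continuous φ) {z₀ zs : PrimalDual dx dy} (hz₀ : z₀ ∈ Z)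
    (hzs : zs ∈ Z) {η : ℝ} (hη : 0 < η)
    (hv : ∀ k, Measurable (v k)) (hw : ∀ k, Measurable (w k))
    (hv_law : ∀ k, μ.map (v k) = uniformSphere dx dy)
    (hw_law : ∀ k, μ.map (w k) = uniformSphere dx dy)
    (hindep : iIndepFun (Sum.elim v w) μ) {V β : ℕ → ℝ}
    (hV : ∀ k, ∀ z ∈ Z, ∫ u, ‖gradEst f (r k) z u‖ ^ 2 ∂(uniformSphere dx dy) ≤ V k)
    (hβ : ∀ k, ∀ z ∈ Z,
      φ z ≤ ∫ u, inner ℝ (gradEst f (r k) z u) (z - zs) ∂(uniformSphere dx dy) + β k) (n : ℕ) :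
    2 * η * ∑ k ∈ Finset.range n,
        ∫ ω, φ (zoegMid f Z η r z₀ (fun k => v k ω) (fun k => w k ω) (k + 1)) ∂μ ≤
      diam Z ^ 2 + 3 * η ^ 2 * ∑ k ∈ Finset.range n, V (k + 1)
        + 2 * η * ∑ k ∈ Finset.range n, β (k + 1) := by
  have hstep := fun k => integral_zoegMid_step_le hZ hconv hf hφ hz₀ hzs hη hv hw hv_law hw_law
    hindep (hV k) (hβ k)
  set q : ℕ → ℝ := fun k =>
    ∫ ω, ‖zoegIter f Z η r z₀ (fun k => v k ω) (fun k => w k ω) k - zs‖ ^ 2 ∂μ with hq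
  have hsum := Finset.sum_le_sum fun k (_ : k ∈ Finset.range n) => hstep (k + 1)
  simp only [Finset.sum_add_distrib, ← Finset.mul_sum] at hsum
  have htel := Finset.sum_range_sub' (fun k => q (k + 1)) n
  have hqn : 0 ≤ q (n + 1) := integral_nonneg fun ω => by positivity
  -- The telescope starts at z_1, which is random; only its membership in Z is used.
  have hq1 : q 1 ≤ diam Z ^ 2 := by
    have hmem := fun ω => zoegIter_mem (f := f) hZ η r hz₀ (fun k => (v k ω).1)
      (fun k => (w k ω).1) 1
    have : ∫ _ω, diam Z ^ 2 ∂μ = diam Z ^ 2 := by simp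
    rw [← this]
    refine integral_mono (integrable_comp_of_isCompact hZ (ψ := fun z => ‖z - zs‖ ^ 2)
      (by fun_prop) ((measurable_zoegIter hZ hconv ⟨z₀, hz₀⟩ hf η z₀ 1).mono
        (directionsIn_le hv hw _) le_rfl) hmem) (integrable_const _) fun ω => ?_
    have := dist_le_diam_of_mem hZ.isBounded (hmem ω) hzs
    rw [dist_eq_norm] at this
    exact pow_le_pow_left₀ (norm_nonneg _) this 2
  simp only [zero_add] at htel
  linarith

end Convergence

/-! ### Absorbing iteration 0, and the main theorem -/

theorem average_gap_le {E G D L η M₁ M₂ T d K : ℝ} (hη : 0 < η) (hK : 0 < K) (hd : 1 ≤ d)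
    (hG : 0 ≤ G) (hD : 0 ≤ D) (hL : 0 ≤ L) (hM₁ : 0 ≤ M₁) (hM₂ : 0 ≤ M₂)
    (hE : E ≤ G * D) (hKE : K * E ≤ G * D + T)
    (hT : 2 * η * T ≤ D ^ 2 + 3 * η ^ 2 * (K * (2 * d * G ^ 2) + 2 * d ^ 2 * L ^ 2 * M₂)
      + 2 * η * (L * D * M₁)) :
    E ≤ D ^ 2 / (2 * η * K) + ((9 * L ^ 2 + 12) * d ^ 2 * M₂ * η + L * D * M₁) / K
      + 108 * η * d * G ^ 2 := by
  -- Here T is the total expected gap over iterations k ≥ 1, and G D the cost of iteration 0. If G D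
  -- ≤ D²/(2ηK), the trivial bound E ≤ G D suffices. Otherwise D < 2ηKG, so G D ≤ 2ηKdG² has the
  -- size of the noise term: it brings that term to 5ηdG² after division by K, well below the 108
  -- allowed.
  rcases le_or_gt (G * D) (D ^ 2 / (2 * η * K)) with h | h
  · have h1 : 0 ≤ ((9 * L ^ 2 + 12) * d ^ 2 * M₂ * η + L * D * M₁) / K := by positivity
    have h2 : 0 ≤ 108 * η * d * G ^ 2 := by positivity
    linarith
  · rw [div_lt_iff₀ (by positivity)] at h
    have hDpos : 0 < D := lt_of_le_of_ne hD fun h0 => by simp [← h0] at h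
    have hDG : D < 2 * η * K * G := by
      refine lt_of_mul_lt_mul_right ?_ hD
      nlinarith
    have h1 : G * D ≤ K * (2 * η * d * G ^ 2) := by
      have h2 : G * D ≤ G * (2 * η * K * G) := by gcongr
      have h3 : 2 * η * K * G ^ 2 * 1 ≤ 2 * η * K * G ^ 2 * d := by gcongr
      linarith
    have h4 : T ≤ D ^ 2 / (2 * η) + 3 * η * (K * (d * G ^ 2) + d ^ 2 * L ^ 2 * M₂)
        + L * D * M₁ := by
      refine le_of_mul_le_mul_left (hT.trans (le_of_eq ?_)) (by positivity : 0 < 2 * η)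
      field_simp
    have h5 : 0 ≤ (6 * L ^ 2 + 12) * d ^ 2 * M₂ * η := by positivity
    have h6 : 0 ≤ K * (103 * η * d * G ^ 2) := by positivity
    refine le_of_mul_le_mul_left ?_ hK
    have h7 : K * (D ^ 2 / (2 * η * K) + ((9 * L ^ 2 + 12) * d ^ 2 * M₂ * η + L * D * M₁) / K
        + 108 * η * d * G ^ 2) = D ^ 2 / (2 * η) + ((9 * L ^ 2 + 12) * d ^ 2 * M₂ * η + L * D * M₁)
        + K * (108 * η * d * G ^ 2) := by
      field_simp
    rw [h7]
    linarith

theorem nonneg_of_abs_le_mul_norm {E : Type*} [NormedAddCommGroup E] {a c : ℝ} {z₁ z₂ : E}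
    (h : z₁ ≠ z₂) (ha : 0 ≤ a) (hac : a ≤ c * ‖z₁ - z₂‖) : 0 ≤ c :=
  nonneg_of_mul_nonneg_left (ha.trans hac) (norm_pos_iff.2 (sub_ne_zero.2 h))

theorem mainTheorem3 {dx dy : ℕ}
    (X : Set (EuclideanSpace ℝ (Fin dx))) (Y : Set (EuclideanSpace ℝ (Fin dy)))
    (f : PrimalDual dx dy → ℝ) (r : ℕ → ℝ) (G L η M₁ M₂ : ℝ)
    -- the feasible set is compact and convex
    (hcompact : IsCompact (feasibleSet X Y)) (hconvex : Convex ℝ (feasibleSet X Y))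
    -- `f` is continuously differentiable where it is queried, convex in `x`, concave in `y`
    (hdiff : ∀ p ∈ queryRegion (feasibleSet X Y) r, DifferentiableAt ℝ f p)
    (hcont : ContinuousOn (gradient f) (queryRegion (feasibleSet X Y) r))
    (hx : ∀ y ∈ Y, ConvexOn ℝ X (fun x => f (concat x y)))
    (hy : ∀ x ∈ X, ConcaveOn ℝ Y (fun y => f (concat x y)))
    -- `f` is `L`-smooth and `G`-Lipschitz where it is queried
    (hsmooth : ∀ z₁ ∈ queryRegion (feasibleSet X Y) r, ∀ z₂ ∈ queryRegion (feasibleSet X Y) r,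
      ‖gradient f z₁ - gradient f z₂‖ ≤ L * ‖z₁ - z₂‖)
    (hlip : ∀ z₁ ∈ queryRegion (feasibleSet X Y) r, ∀ z₂ ∈ queryRegion (feasibleSet X Y) r,
      |f z₁ - f z₂| ≤ G * ‖z₁ - z₂‖)
    -- the saddle point
    (xs : EuclideanSpace ℝ (Fin dx)) (ys : EuclideanSpace ℝ (Fin dy))
    (hxs : xs ∈ X) (hys : ys ∈ Y)
    (hsaddle : IsSaddlePointOn X Y (fun x y => f (concat x y)) xs ys)
    -- step size, smoothing radii, initial point
    (hη : 0 < η) (hr : ∀ k, 0 < r k)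
    (hM₁ : HasSum (fun k => r (k + 1)) M₁) (hM₂ : HasSum (fun k => r (k + 1) ^ 2) M₂)
    (z₀ : PrimalDual dx dy) (hz₀ : z₀ ∈ feasibleSet X Y)
    -- independent directions, uniform on the unit sphere
    {Ω : Type*} [MeasurableSpace Ω] (μ : Measure Ω) [IsProbabilityMeasure μ]
    (v w : ℕ → Ω → Metric.sphere (0 : PrimalDual dx dy) 1)
    (hv : ∀ k, Measurable (v k)) (hw : ∀ k, Measurable (w k))
    (hv_law : ∀ k, μ.map (v k) = uniformSphere dx dy)
    (hw_law : ∀ k, μ.map (w k) = uniformSphere dx dy)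
    (hindep : iIndepFun (Sum.elim v w) μ)
    (K : ℕ) (hK : 1 < K) :
    Integrable (fun ω => dualityGap f xs ys
      (zoegOutput f (feasibleSet X Y) η r z₀ (fun k => v k ω) (fun k => w k ω) K)) μ ∧
    ∫ ω, dualityGap f xs ys
      (zoegOutput f (feasibleSet X Y) η r z₀ (fun k => v k ω) (fun k => w k ω) K) ∂μ ≤
      Metric.diam (feasibleSet X Y) ^ 2 / (2 * η * K)
        + ((9 * L ^ 2 + 12) * ((dx + dy : ℕ) : ℝ) ^ 2 * M₂ * η
            + L * Metric.diam (feasibleSet X Y) * M₁) / K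
        + 108 * η * ((dx + dy : ℕ) : ℝ) * G ^ 2 := by
  set Z := feasibleSet X Y with hZdef
  set S := queryRegion Z r with hSdef
  set D := Metric.diam Z with hD
  set zs : PrimalDual dx dy := concat xs ys with hzsdef
  have hzs : zs ∈ Z := concat_mem_feasibleSet hxs hys
  have hne : Z.Nonempty := ⟨z₀, hz₀⟩
  have hballS : ∀ k, ∀ z ∈ Z, Metric.closedBall z (r k) ⊆ S := fun k z hz p hp =>
    ⟨k, z, hz, by simpa [dist_eq_norm] using hp⟩
  have hZS : Z ⊆ S := fun z hz => hballS 0 z hz (Metric.mem_closedBall_self (hr 0).le)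
  obtain ⟨ω₀⟩ : Nonempty Ω := nonempty_of_isProbabilityMeasure μ
  -- The existence of a unit vector forces d ≥ 1. Together with r_0 > 0 it also gives two distinct
  -- points of the query region, whence G ≥ 0 and L ≥ 0.
  obtain ⟨u, hu⟩ := v 0 ω₀
  have hu1 : ‖u‖ = 1 := by simpa using hu
  have hu0 : u ≠ 0 := fun h => by simp [h] at hu1
  have hnonempty : Nonempty (Fin dx ⊕ Fin dy) := by
    by_contra hempty
    rw [not_nonempty_iff] at hempty
    exact hu0 (Subsingleton.elim _ _)
  have hd1 : (1 : ℝ) ≤ ((dx + dy : ℕ) : ℝ) := by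
    have := Fintype.card_pos (α := Fin dx ⊕ Fin dy)
    simp only [Fintype.card_sum, Fintype.card_fin] at this
    exact_mod_cast this
  have hprob : IsProbabilityMeasure (uniformSphere dx dy) := by
    rw [← hv_law 0]
    exact Measure.isProbabilityMeasure_map (hv 0).aemeasurable
  have hpS : ∀ k, ∀ z ∈ Z, ∀ u : PrimalDual dx dy, ‖u‖ = 1 → z + r k • u ∈ S :=
    fun k z hz u hu => hballS k z hz (by simp [norm_smul, hu, abs_of_pos (hr k)])
  have hne0 : z₀ + r 0 • u ≠ z₀ := by simp [(hr 0).ne', hu0]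
  have hG0 : 0 ≤ G := nonneg_of_abs_le_mul_norm hne0 (abs_nonneg _)
    (hlip _ (hpS 0 z₀ hz₀ u hu1) _ (hZS hz₀))
  have hL0 : 0 ≤ L := nonneg_of_abs_le_mul_norm hne0 (norm_nonneg _)
    (hsmooth _ (hpS 0 z₀ hz₀ u hu1) _ (hZS hz₀))
  have hlipS : LipschitzOnWith ⟨G, hG0⟩ f S :=
    LipschitzOnWith.of_dist_le_mul fun p hp q hq => by
      rw [Real.dist_eq, dist_eq_norm]
      exact hlip p hp q hq
  -- f may be non-measurable off the query region. Its Lipschitz extension f' is continuous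
  -- everywhere and yields the same iterates and gaps; gradients are still taken of f.
  obtain ⟨f', hf'lip, hff'⟩ := hlipS.extend_real
  have hf' : Continuous f' := hf'lip.continuous
  have hest : ∀ k, ∀ z ∈ Z, ∀ u, ‖u‖ = 1 → gradEst f (r k) z u = gradEst f' (r k) z u :=
    fun k z hz u hu => by rw [gradEst, gradEst, hff' (hpS k z hz u hu), hff' (hZS hz)]
  have hgap : ∀ z ∈ Z, dualityGap f xs ys z = dualityGap f' xs ys z := fun z hz => by
    rw [dualityGap, dualityGap, hff' (hZS (concat_mem_feasibleSet hz.1 hys)),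
      hff' (hZS (concat_mem_feasibleSet hxs hz.2))]
  have hφ : Continuous (dualityGap f' xs ys) := by
    have h1 : Continuous fun z : PrimalDual dx dy => (concat (xPart z) ys : PrimalDual dx dy) :=
      continuous_concat.comp (continuous_xPart.prodMk continuous_const)
    have h2 : Continuous fun z : PrimalDual dx dy => (concat xs (yPart z) : PrimalDual dx dy) :=
      continuous_concat.comp (continuous_const.prodMk continuous_yPart)
    exact (hf'.comp h1).sub (hf'.comp h2)
  have hdist : ∀ z ∈ Z, ‖z - zs‖ ≤ D := fun z hz => by
    rw [← dist_eq_norm]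
    exact Metric.dist_le_diam_of_mem hcompact.isBounded hz hzs
  have hgapD : ∀ z ∈ Z, dualityGap f' xs ys z ≤ G * D := fun z hz => by
    rw [← hgap z hz]
    exact (le_abs_self _).trans ((dualityGap_le_norm (fun p hp q hq => hlip p (hZS hp) q (hZS hq))
      hxs hys hz).trans (mul_le_mul_of_nonneg_left (hdist z hz) hG0))
  have hLball : ∀ k, ∀ z ∈ Z, ∀ p ∈ Metric.closedBall z (r k),
      ‖gradient f p - gradient f z‖ ≤ L * r k := fun k z hz p hp =>
    (hsmooth p (hballS k z hz hp) z (hZS hz)).trans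
      (mul_le_mul_of_nonneg_left (by simpa [dist_eq_norm] using hp) hL0)
  have hgradG : ∀ z ∈ Z, ‖gradient f z‖ ≤ G := fun z hz =>
    norm_gradient_le_of_lipschitz (hr 0) hG0 fun p hp =>
      hlip p (hballS 0 z hz hp) z (hZS hz)
  set d : ℝ := ((dx + dy : ℕ) : ℝ) with hd
  have hV : ∀ k, ∀ z ∈ Z, ∫ u, ‖gradEst f' (r k) z u‖ ^ 2 ∂(uniformSphere dx dy) ≤
      2 * d * G ^ 2 + 2 * d ^ 2 * L ^ 2 * r k ^ 2 := fun k z hz => by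
    simp only [← hest k z hz _ (norm_eq_of_mem_sphere _)]
    exact integral_norm_gradEst_sq_le (hr k) (fun p hp => hdiff p (hballS k z hz hp))
      (hLball k z hz) (hgradG z hz)
  have hβ : ∀ k, ∀ z ∈ Z, dualityGap f' xs ys z ≤
      ∫ u, inner ℝ (gradEst f' (r k) z u) (z - zs) ∂(uniformSphere dx dy) + L * D * r k :=
    fun k z hz => by
      simp only [← hest k z hz _ (norm_eq_of_mem_sphere _)]
      rw [← hgap z hz]
      have h1 := dualityGap_le_inner hx hy hxs hys hz (hdiff z (hZS hz))
      have h2 := inner_gradient_le_integral (hr k) (fun p hp => hdiff p (hballS k z hz hp))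
        (hcont.mono (hballS k z hz)) (hLball k z hz) (z - zs)
      have h3 : L * r k * ‖z - zs‖ ≤ L * r k * D :=
        mul_le_mul_of_nonneg_left (hdist z hz) (mul_nonneg hL0 (hr k).le)
      linarith
  have hmid : ∀ ω k, zoegMid f Z η r z₀ (fun k => v k ω) (fun k => w k ω) k =
      zoegMid f' Z η r z₀ (fun k => v k ω) (fun k => w k ω) k := fun ω k =>
    zoegMid_congr hcompact hest η hz₀ (fun k => norm_eq_of_mem_sphere _)
      (fun k => norm_eq_of_mem_sphere _) k
  have hout : ∀ ω, dualityGap f xs ys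
      (zoegOutput f Z η r z₀ (fun k => v k ω) (fun k => w k ω) K) = dualityGap f' xs ys
      (zoegOutput f' Z η r z₀ (fun k => v k ω) (fun k => w k ω) K) := fun ω => by
    rw [hgap _ (zoegOutput_mem hcompact hconvex hne η r z₀ _ _ (by omega)), zoegOutput,
      zoegOutput]
    simp only [hmid ω]
  have hmidmeas : ∀ k, Measurable fun ω =>
      zoegMid f' Z η r z₀ (fun k => v k ω) (fun k => w k ω) k := fun k =>
    (measurable_zoegMid hcompact hconvex hne hf' η z₀ k).mono (directionsIn_le hv hw _) le_rfl
  have hmidmem : ∀ k ω, zoegMid f' Z η r z₀ (fun k => v k ω) (fun k => w k ω) k ∈ Z :=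
    fun k ω => zoegMid_mem hcompact hne η r z₀ _ _ k
  have houtmem : ∀ ω, zoegOutput f' Z η r z₀ (fun k => v k ω) (fun k => w k ω) K ∈ Z :=
    fun ω => zoegOutput_mem hcompact hconvex hne η r z₀ _ _ (by omega)
  have houtmeas : Measurable fun ω =>
      zoegOutput f' Z η r z₀ (fun k => v k ω) (fun k => w k ω) K := by
    simp only [zoegOutput]
    exact (Finset.measurable_sum _ fun k _ => hmidmeas k).const_smul (1 / (K : ℝ))
  have hintout := integrable_comp_of_isCompact (μ := μ) hcompact hφ houtmeas houtmem
  have hintmid := fun k => integrable_comp_of_isCompact (μ := μ) hcompact hφ (hmidmeas k) (hmidmem k)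
  have hconst : ∫ _ω, G * D ∂μ = G * D := by simp
  simp only [hout]
  refine ⟨hintout, ?_⟩
  have hKpos : (0 : ℝ) < K := by exact_mod_cast (by omega : 0 < K)
  have hM₁0 : 0 ≤ M₁ := hM₁.nonneg fun k => (hr _).le
  have hM₂0 : 0 ≤ M₂ := hM₂.nonneg fun k => by positivity
  -- Splits off iteration 0, leaving the n iterations whose radii the sums M₁ and M₂ control.
  obtain ⟨n, rfl⟩ : ∃ n, K = n + 1 := ⟨K - 1, by omega⟩
  have hjensen : ∀ ω, ((n + 1 : ℕ) : ℝ) * dualityGap f' xs ys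
      (zoegOutput f' Z η r z₀ (fun k => v k ω) (fun k => w k ω) (n + 1)) ≤
      ∑ k ∈ Finset.range (n + 1), dualityGap f' xs ys
        (zoegMid f' Z η r z₀ (fun k => v k ω) (fun k => w k ω) k) := by
    intro ω
    have := (convexOn_dualityGap hconvex hx hy hxs hys).map_sum_le (t := Finset.range (n + 1))
      (w := fun _ => 1 / ((n + 1 : ℕ) : ℝ)) (fun _ _ => by positivity)
      (by simp only [Finset.sum_const, Finset.card_range, nsmul_eq_mul]; field_simp)
      (fun k _ => hmidmem k ω)
    rw [← Finset.smul_sum, ← zoegOutput, hgap _ (houtmem ω)] at this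
    simp only [hgap _ (hmidmem _ ω), smul_eq_mul, ← Finset.mul_sum] at this
    rwa [one_div, ← div_eq_inv_mul, le_div_iff₀' hKpos] at this
  refine average_gap_le (T := ∑ k ∈ Finset.range n, ∫ ω, dualityGap f' xs ys
    (zoegMid f' Z η r z₀ (fun k => v k ω) (fun k => w k ω) (k + 1)) ∂μ) hη hKpos hd1 hG0
    Metric.diam_nonneg hL0 hM₁0 hM₂0 ?_ ?_ ?_
  · rw [← hconst]
    exact integral_mono hintout (integrable_const _) fun ω => hgapD _ (houtmem ω)
  · rw [← integral_const_mul]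
    refine (integral_mono (hintout.const_mul _) (integrable_finsetSum _ fun k _ => hintmid k)
      hjensen).trans ?_
    rw [integral_finsetSum _ fun k _ => hintmid k, Finset.sum_range_succ', add_comm]
    gcongr
    rw [← hconst]
    exact integral_mono (hintmid 0) (integrable_const _) fun ω => hgapD _ (hmidmem 0 ω)
  · have h := sum_integral_zoegMid_le hcompact hconvex hf' hφ hz₀ hzs hη hv hw hv_law hw_law hindep
      hV hβ n
    have h1 : ∑ k ∈ Finset.range n, r (k + 1) ≤ M₁ :=
      sum_le_hasSum _ (fun k _ => (hr _).le) hM₁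
    have h2 : ∑ k ∈ Finset.range n, r (k + 1) ^ 2 ≤ M₂ :=
      sum_le_hasSum _ (fun k _ => by positivity) hM₂
    simp only [Finset.sum_add_distrib, Finset.sum_const, Finset.card_range, nsmul_eq_mul,
      ← Finset.mul_sum] at h
    refine h.trans ?_
    have hd0 : 0 ≤ d := by linarith
    have hD0 : 0 ≤ D := Metric.diam_nonneg
    gcongr
    -- The n noise terms 2dG² are bounded by K = n + 1 of them.
    exact Nat.le_succ n
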